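/- Setting. Let $(M,\omega)$ be a symplectic manifold (Hausdorff, second countable), $C^\infty(M)$ its complex-valued smooth functions, and $\{f,g\}=\omega(X_f,X_g)$ with $i_{X_f}\omega=df$. Let $f*g=\sum_{r\ge 0}\lambda^rC_r(f,g)$ be a star product on $C^\infty(M)[[\lambda]]$: associative and $\mathbb C[[\lambda]]$-bilinear, with bidifferential operators $C_r$, $C_0(f,g)=fg$, $C_1(f,g)-C_1(g,f)=\mathrm i\{f,g\}$, and $C_r(1,\cdot)=0=C_r(\cdot,1)$ for $r\ge 1$. Let $\mathfrak g$ be a finite-dimensional real Lie algebra with basis $(e_a)$ and dual basis $(e^a)$, and let $\mathbf J=\sum_r\lambda^r\mathbf J_r$, with smooth $\mathbf J_r:M\to\mathfrak g^*$, be a quantum momentum map, i.e. $\langle\mathbf J,\xi\rangle*\langle\mathbf J,\eta\rangle-\langle\mathbf J,\eta\rangle*\langle\mathbf J,\xi\rangle=\mathrm i\lambda\langle\mathbf J,[\xi,\eta]\rangle$ for all $\xi,\eta\in\mathfrak g$; put $J=\mathbf J_0$ and $\mathbf J_a=\langle\mathbf J,e_a\rangle$. Assume that $0$ is a regular value of $J$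 and that $C=J^{-1}(0)$ is non-empty, and let $\iota:C\to M$ be the inclusion of this embedded submanifold. Koszul operators. On $\Lambda\mathfrak g\otimes C^\infty(M)$ let $\partial=i(J)=\sum_a\langle J,e_a\rangle\, i(e^a)$. On $(\Lambda\mathfrak g\otimes C^\infty(M))[[\lambda]]$ let $$\hat\partial(x\otimes F)=\sum_a i(e^a)x\otimes(F*\mathbf J_a)+\mathrm i\lambda\left(\tfrac12u-q\right)(x\otimes F),$$ where $u$ is insertion of the linear form $\xi\mapsto\operatorname{tr}(\operatorname{ad}\xi)$ and $q=-\frac12\sum_{a,b}[e_a,e_b]\wedge i(e^a)i(e^b)$, both acting on the factor $\Lambda\mathfrak g$. Write $\partial_1$, $\hat\partial_1$ for the restrictions to $\mathfrak g\otimes C^\infty(M)$ and $(\mathfrak g\otimes C^\infty(M))[[\lambda]]$, and let $\mathfrak J_C=\hat\partial_1\big((\mathfrak g\otimes C^\infty(M))[[\lambda]]\big)\subset C^\infty(M)[[\lambda]]$ be the quantum vanishing ideal. Let $(\mathrm{prol},h)$ be a chain homotopy of the augmented Koszul complex: $\mathbb C$-linear maps $\mathrm{prol}:C^\infty(C)\to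 C^\infty(M)$ and $h_i:\Lambda^i\mathfrak g\otimes C^\infty(M)\to\Lambda^{i+1}\mathfrak g\otimes C^\infty(M)$, $i\ge 0$, with $$\iota^*\,\mathrm{prol}=\mathrm{id},\qquad \mathrm{prol}\,\iota^*+\partial_1h_0=\mathrm{id},\qquad h_{i-1}\partial_i+\partial_{i+1}h_i=\mathrm{id}\ (i\ge1),\qquad h_0\,\mathrm{prol}=0 .$$ Put $\mathcal F_C=\mathrm{prol}(C^\infty(C))$. Each of the maps $T=\iota^*,\mathrm{prol},h_0,\partial_1,\hat\partial_1$ is extended to the tensor product with $\Lambda\mathfrak g^*$ by $T(\alpha\otimes v)=(-1)^k\alpha\otimes Tv$ for $\alpha\in\Lambda^k\mathfrak g^*$, and $\lambda$-linearly to formal power series in $\lambda$. Proposition. The map $B_1=\frac1\lambda(\partial_1-\hat\partial_1)$ is well defined, $\mathrm{id}-\lambda B_1h_0$ is invertible on $\Lambda\mathfrak g^*\otimes C^\infty(M)[[\lambda]]$, and the deformed restriction map $$\boldsymbol\iota^*:=\iota^*(\mathrm{id}-\lambda B_1h_0)^{-1}=\sum_{r\ge0}\lambda^r\boldsymbol\iota^*_r$$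 is the unique $\mathbb C[[\lambda]]$-linear map $\Lambda\mathfrak g^*\otimes C^\infty(M)[[\lambda]]\to\Lambda\mathfrak g^*\otimes C^\infty(C)[[\lambda]]$ which satisfies $$\boldsymbol\iota^*_0=\iota^*,\qquad \boldsymbol\iota^*\,\hat\partial_1=0,\qquad \boldsymbol\iota^*\,\mathrm{prol}=\mathrm{id}.$$ Moreover $\mathrm{prol}\,\boldsymbol\iota^*$ is a projection onto $(\Lambda\mathfrak g^*\otimes\mathcal F_C)[[\lambda]]$ with kernel $\Lambda\mathfrak g^*\otimes\mathfrak J_C$. In particular $$\Lambda\mathfrak g^*\otimes C^\infty(M)[[\lambda]]=(\Lambda\mathfrak g^*\otimes\mathcal F_C)[[\lambda]]\oplus(\Lambda\mathfrak g^*\otimes\mathfrak J_C).$$ -/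

import Mathlib

open scoped Manifold ContDiff TensorProduct
open Finset.HasAntidiagonal (antidiagonal)

noncomputable section

namespace BRST

/-! ### Formal power series with values in a module -/

/-- `V[[λ]]`: formal power series in `λ` with coefficients in `V`. -/
@[ext] structure FormalSeries (V : Type*) where
  /-- The coefficient of `λ ^ n`. -/
  coeff : ℕ → V

namespace FormalSeries

section
variable {V : Type*} [AddCommGroup V]

instance : Zero (FormalSeries V) := ⟨⟨fun _ => 0⟩⟩
instance : Add (FormalSeries V) := ⟨fun f g => ⟨fun n => f.coeff n + g.coeff n⟩⟩
instance : Neg (FormalSeries V) := ⟨fun f => ⟨fun n => -f.coeff n⟩⟩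

@[simp] theorem coeff_zero (n : ℕ) : (0 : FormalSeries V).coeff n = 0 := rfl
@[simp] theorem coeff_add (f g : FormalSeries V) (n : ℕ) :
    (f + g).coeff n = f.coeff n + g.coeff n := rfl
@[simp] theorem coeff_neg (f : FormalSeries V) (n : ℕ) : (-f).coeff n = -f.coeff n := rfl

instance : AddCommGroup (FormalSeries V) where
  add_assoc f g h := by ext n; simp [add_assoc]
  zero_add f := by ext n; simp
  add_zero f := by ext n; simp
  add_comm f g := by ext n; simp [add_comm]
  neg_add_cancel f := by ext n; simp
  nsmul := nsmulRec
  zsmul := zsmulRec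
end

variable {V W : Type*} [AddCommGroup V] [Module ℂ V] [AddCommGroup W] [Module ℂ W]

instance : SMul (PowerSeries ℂ) (FormalSeries V) where
  smul a f := ⟨fun n => ∑ p ∈ antidiagonal n, PowerSeries.coeff p.1 a • f.coeff p.2⟩

theorem coeff_smul (a : PowerSeries ℂ) (f : FormalSeries V) (n : ℕ) :
    (a • f).coeff n = ∑ p ∈ antidiagonal n, PowerSeries.coeff p.1 a • f.coeff p.2 := rfl

theorem coeff_C_smul (c : ℂ) (f : FormalSeries V) (n : ℕ) :
    (PowerSeries.C c • f).coeff n = c • f.coeff n := by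
  rw [coeff_smul, Finset.sum_eq_single (0, n)]
  · simp
  · rintro ⟨i, j⟩ hp hne
    have hi : i ≠ 0 := by
      rintro rfl
      simp at hp
      exact hne (by simp [hp])
    simp [PowerSeries.coeff_C, hi]
  · intro h
    simp at h

/-- `V[[λ]]` is a `ℂ[[λ]]`-module under the Cauchy product. -/
instance : Module (PowerSeries ℂ) (FormalSeries V) where
  one_smul f := by
    ext n
    simpa using coeff_C_smul (1 : ℂ) f n
  mul_smul a b f := by
    ext n
    simp only [coeff_smul, PowerSeries.coeff_mul, Finset.sum_smul, Finset.smul_sum, smul_smul]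
    rw [Finset.sum_sigma', Finset.sum_sigma']
    refine Finset.sum_nbij' (fun x => ⟨(x.2.1, x.2.2 + x.1.2), (x.2.2, x.1.2)⟩)
      (fun x => ⟨(x.1.1 + x.2.1, x.2.2), (x.1.1, x.2.1)⟩) ?_ ?_ ?_ ?_ ?_ <;>
    · rintro ⟨⟨i, j⟩, ⟨k, l⟩⟩ h
      simp only [Finset.mem_sigma, Finset.HasAntidiagonal.mem_antidiagonal] at h ⊢
      try obtain ⟨h1, h2⟩ := h
      try subst h2
      try subst h1
      try simp [add_assoc]
  smul_zero a := by ext n; simp [coeff_smul]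
  smul_add a f g := by ext n; simp [coeff_smul, Finset.sum_add_distrib]
  add_smul a b f := by ext n; simp [coeff_smul, add_smul, Finset.sum_add_distrib]
  zero_smul f := by ext n; simp [coeff_smul]

/-- A vector as a constant series. -/
def const (v : V) : FormalSeries V := ⟨fun n => if n = 0 then v else 0⟩

/-- The `ℂ[[λ]]`-linear map `T = ∑ λ ^ r T_r` with given coefficients `T_r : V → W`. -/
def ofCoeffs (T : ℕ → V →ₗ[ℂ] W) :
    FormalSeries V →ₗ[PowerSeries ℂ] FormalSeries W where
  toFun f := ⟨fun n => ∑ p ∈ antidiagonal n, T p.1 (f.coeff p.2)⟩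
  map_add' f g := by ext n; simp [Finset.sum_add_distrib]
  map_smul' a f := by
    ext n
    simp only [coeff_smul, map_sum, map_smul, Finset.smul_sum, RingHom.id_apply]
    rw [Finset.sum_sigma', Finset.sum_sigma']
    refine Finset.sum_nbij' (fun x => ⟨(x.2.1, x.1.1 + x.2.2), (x.1.1, x.2.2)⟩)
      (fun x => ⟨(x.2.1, x.1.1 + x.2.2), (x.1.1, x.2.2)⟩) ?_ ?_ ?_ ?_ ?_ <;>
    · rintro ⟨⟨i, j⟩, ⟨k, l⟩⟩ h
      simp only [Finset.mem_sigma, Finset.HasAntidiagonal.mem_antidiagonal] at h ⊢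
      try obtain ⟨h1, h2⟩ := h
      try subst h2
      try subst h1
      try simp [add_left_comm]

/-- The `λ`-linear extension of a `ℂ`-linear map. -/
def map (T : V →ₗ[ℂ] W) : FormalSeries V →ₗ[PowerSeries ℂ] FormalSeries W :=
  ofCoeffs fun r => if r = 0 then T else 0

/-- The coefficient `T_r : V → W` of a `ℂ[[λ]]`-linear map `T = ∑ λ ^ r T_r`. -/
def opCoeff (T : FormalSeries V →ₗ[PowerSeries ℂ] FormalSeries W) (r : ℕ) : V →ₗ[ℂ] W where
  toFun v := (T (const v)).coeff r
  map_add' v w := by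
    have : const (v + w) = const v + const w := by
      ext n; by_cases h : n = 0 <;> simp [const, h]
    rw [this, map_add, coeff_add]
  map_smul' c v := by
    have : const (c • v) = PowerSeries.C c • const v := by
      ext n; rw [coeff_C_smul]; by_cases h : n = 0 <;> simp [const, h]
    rw [this, map_smul, coeff_C_smul, RingHom.id_apply]

/-- `(1 / λ) T = ∑ λ ^ r T_{r+1}`, for a `ℂ[[λ]]`-linear map `T` with `T_0 = 0`. -/
def divLambda (T : FormalSeries V →ₗ[PowerSeries ℂ] FormalSeries W) :
    FormalSeries V →ₗ[PowerSeries ℂ] FormalSeries W :=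
  ofCoeffs fun r => opCoeff T (r + 1)

/-- `P[[λ]]`, for a subspace `P` of `V`: the series with all coefficients in `P`. -/
def sub (P : Submodule ℂ V) : Submodule (PowerSeries ℂ) (FormalSeries V) where
  carrier := {f | ∀ n, f.coeff n ∈ P}
  add_mem' hf hg n := P.add_mem (hf n) (hg n)
  zero_mem' _ := P.zero_mem
  smul_mem' a f hf n := by
    rw [coeff_smul]
    exact P.sum_mem fun _ _ => P.smul_mem _ (hf _)

end FormalSeries

/-! ### Smooth functions, symplectic forms and Poisson brackets -/

section Geometry

variable (E : Type*) [NormedAddCommGroup E] [NormedSpace ℝ E]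
  (M : Type*) [TopologicalSpace M] [ChartedSpace E M]

/-- `C^∞(M)`: the algebra of complex-valued smooth functions on a manifold `M` modelled on `E`. -/
def Smooth : Subalgebra ℂ (M → ℂ) where
  carrier := {f | ContMDiff 𝓘(ℝ, E) 𝓘(ℝ, ℂ) ∞ f}
  mul_mem' hf hg := (contDiff_mul (𝕜 := ℝ) (𝔸 := ℂ)).contMDiff.comp (hf.prodMk_space hg)
  add_mem' hf hg := ContMDiff.add hf hg
  algebraMap_mem' _ := contMDiff_const

variable {E M}

/-- The pull-back `ι^* : C^∞(M) → C^∞(C)` along a smooth map `ι : C → M`. -/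
def pullback {F : Type*} [NormedAddCommGroup F] [NormedSpace ℝ F]
    {C : Type*} [TopologicalSpace C] [ChartedSpace F C] (ι : C → M)
    (hι : ContMDiff 𝓘(ℝ, F) 𝓘(ℝ, E) ∞ ι) : Smooth E M →ₗ[ℂ] Smooth F C where
  toFun f := ⟨fun c => f.1 (ι c), ContMDiff.comp f.2 hι⟩
  map_add' _ _ := rfl
  map_smul' _ _ := rfl

/-- A field of alternating two-forms on `M`, read in the chart around `x₀`. -/
def formInChart (Ω : ∀ x : M, TangentSpace 𝓘(ℝ, E) x [⋀^Fin 2]→L[ℝ] ℝ) (x₀ : M) (y : E) :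
    E [⋀^Fin 2]→L[ℝ] ℝ :=
  (Ω ((extChartAt 𝓘(ℝ, E) x₀).symm y)).compContinuousLinearMap
    (mfderiv 𝓘(ℝ, E) 𝓘(ℝ, E) (extChartAt 𝓘(ℝ, E) x₀).symm y)

variable (E M) in
/-- A symplectic form on `M`: a smooth, closed, non-degenerate two-form. -/
structure SymplecticForm where
  /-- The value of the form at a point. -/
  form : ∀ x : M, TangentSpace 𝓘(ℝ, E) x [⋀^Fin 2]→L[ℝ] ℝ
  smooth : ∀ x₀ : M, ContDiffOn ℝ ∞ (formInChart form x₀) (extChartAt 𝓘(ℝ, E) x₀).target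
  closed : ∀ x₀ : M, ∀ y ∈ (extChartAt 𝓘(ℝ, E) x₀).target, extDeriv (formInChart form x₀) y = 0
  nondegenerate : ∀ (x : M) (v : TangentSpace 𝓘(ℝ, E) x), (∀ w, form x ![v, w] = 0) → v = 0

theorem update₀ {T : Type*} (v w a : T) : Function.update ![v, w] 0 a = ![a, w] := by
  ext i; fin_cases i <;> simp

theorem update₁ {T : Type*} (v w a : T) : Function.update ![v, w] 1 a = ![v, a] := by
  ext i; fin_cases i <;> simp

namespace SymplecticForm

variable (Ω : SymplecticForm E M)

/-- The interior product `v ↦ i_v Ω = Ω (v, ·)` at the point `x`. -/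
def flat (x : M) : TangentSpace 𝓘(ℝ, E) x →ₗ[ℝ] Module.Dual ℝ (TangentSpace 𝓘(ℝ, E) x) :=
  LinearMap.mk₂ ℝ (fun v w => Ω.form x ![v, w])
    (fun v₁ v₂ w => by
      have h := (Ω.form x).map_update_add ![v₁, w] 0 v₁ v₂
      rwa [update₀, update₀, update₀] at h)
    (fun c v w => by
      have h := (Ω.form x).map_update_smul ![v, w] 0 c v
      rwa [update₀, update₀] at h)
    (fun v w₁ w₂ => by
      have h := (Ω.form x).map_update_add ![v, w₁] 1 w₁ w₂
      rwa [update₁, update₁, update₁] at h)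
    (fun c v w => by
      have h := (Ω.form x).map_update_smul ![v, w] 1 c w
      rwa [update₁, update₁] at h)

theorem flat_injective (x : M) : Function.Injective (Ω.flat x) := by
  rw [injective_iff_map_eq_zero]
  exact fun v hv => Ω.nondegenerate x v fun w => LinearMap.congr_fun hv w

variable [FiniteDimensional ℝ E]

/-- The Hamiltonian vector of a real-valued function `u` at `x`: the tangent vector `X` with
`i_X Ω = du`. -/
def hamVec (u : M → ℝ) (x : M) : TangentSpace 𝓘(ℝ, E) x :=
  haveI : FiniteDimensional ℝ (TangentSpace 𝓘(ℝ, E) x) := inferInstanceAs (FiniteDimensional ℝ E)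
  (LinearMap.linearEquivOfInjective (Ω.flat x) (Ω.flat_injective x)
    Subspace.dual_finrank_eq.symm).symm
    (mfderiv 𝓘(ℝ, E) 𝓘(ℝ, ℝ) u x : TangentSpace 𝓘(ℝ, E) x →L[ℝ] ℝ).toLinearMap

/-- The Poisson bracket `{u, v} = Ω (X_u, X_v)` of real-valued functions. -/
def realPoisson (u v : M → ℝ) (x : M) : ℝ := Ω.form x ![Ω.hamVec u x, Ω.hamVec v x]

/-- The complex-bilinear extension of the Poisson bracket to complex-valued functions. -/
def poisson (f g : M → ℂ) (x : M) : ℂ :=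
  ⟨Ω.realPoisson (fun y => (f y).re) (fun y => (g y).re) x
      - Ω.realPoisson (fun y => (f y).im) (fun y => (g y).im) x,
    Ω.realPoisson (fun y => (f y).re) (fun y => (g y).im) x
      + Ω.realPoisson (fun y => (f y).im) (fun y => (g y).re) x⟩

end SymplecticForm

end Geometry

/-! ### Star products and quantum momentum maps -/

/-- Linear differential operators of order at most `k` on a commutative algebra: those of order
`0` are `A`-linear, and `D` has order at most `k + 1` if its commutators with multiplication
operators have order at most `k`. -/
def IsDiffOp {A : Type*} [CommRing A] [Algebra ℂ A] : ℕ → (A →ₗ[ℂ] A) → Prop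
  | 0, D => ∀ a b : A, D (a * b) = a * D b
  | k + 1, D => ∀ a : A,
      IsDiffOp k (D ∘ₗ LinearMap.mulLeft ℂ a - LinearMap.mulLeft ℂ a ∘ₗ D)

/-- A bidifferential operator: a bilinear map which is a differential operator, of bounded
order, in each argument. -/
def IsBidiffOp {A : Type*} [CommRing A] [Algebra ℂ A] (D : A →ₗ[ℂ] A →ₗ[ℂ] A) : Prop :=
  ∃ k, ∀ a, IsDiffOp k (D a) ∧ IsDiffOp k (D.flip a)

section Star

variable {E : Type*} [NormedAddCommGroup E] [NormedSpace ℝ E] [FiniteDimensional ℝ E]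
  {M : Type*} [TopologicalSpace M] [ChartedSpace E M]

/-- A star product `f * g = ∑ λ ^ r C_r (f, g)` on the symplectic manifold `(M, Ω)`. -/
structure StarProduct (Ω : SymplecticForm E M) where
  /-- The bilinear operators `C_r`. -/
  C : ℕ → Smooth E M →ₗ[ℂ] Smooth E M →ₗ[ℂ] Smooth E M
  C_zero : ∀ f g, C 0 f g = f * g
  C_one : ∀ f g x, (C 1 f g).1 x - (C 1 g f).1 x = Complex.I * Ω.poisson f.1 g.1 x
  bidiff : ∀ r, IsBidiffOp (C r)
  C_one_left : ∀ r, r ≠ 0 → ∀ f, C r 1 f = 0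
  C_one_right : ∀ r, r ≠ 0 → ∀ f, C r f 1 = 0
  assoc : ∀ n f g h, ∑ p ∈ antidiagonal n, C p.1 (C p.2 f g) h
    = ∑ p ∈ antidiagonal n, C p.1 f (C p.2 g h)

variable {Ω : SymplecticForm E M} (S : StarProduct Ω)

/-- The coefficient of `λ ^ n` in the operator `f ↦ f * g` on `C^∞(M)[[λ]]`. -/
def StarProduct.rightCoeff (g : FormalSeries (Smooth E M)) (n : ℕ) :
    Smooth E M →ₗ[ℂ] Smooth E M :=
  ∑ p ∈ antidiagonal n, (S.C p.1).flip (g.coeff p.2)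

/-- The `ℂ[[λ]]`-bilinear star product on `C^∞(M)[[λ]]`. -/
def StarProduct.mul (f g : FormalSeries (Smooth E M)) : FormalSeries (Smooth E M) :=
  FormalSeries.ofCoeffs (S.rightCoeff g) f

variable (M) in
/-- The function `⟨J, ξ⟩` as an element of `C^∞(M)`, for `J : M → 𝔤^*` with smooth components. -/
def component {𝔤 : Type*} [AddCommGroup 𝔤] [Module ℝ 𝔤] (J : M → Module.Dual ℝ 𝔤)
    (hJ : ∀ ξ, ContMDiff 𝓘(ℝ, E) 𝓘(ℝ, ℝ) ∞ fun x => J x ξ) (ξ : 𝔤) : Smooth E M :=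
  ⟨fun x => (J x ξ : ℂ), Complex.ofRealCLM.contDiff.contMDiff.comp (hJ ξ)⟩

/-- A quantum momentum map `J = ∑ λ ^ r J_r`, `J_r : M → 𝔤^*`, turning `(M, *)` into a Hamiltonian
quantum `𝔤`-space. Its classical limit `J_0` is the momentum map of the Hamiltonian action by the
vector fields `ξ_M = X_{⟨J_0, ξ⟩}`; the lowest order of `covariant` is the equivariance
`{⟨J_0, ξ⟩, ⟨J_0, η⟩} = ⟨J_0, [ξ, η]⟩`. -/
structure QuantumMomentumMap (𝔤 : Type*) [LieRing 𝔤] [LieAlgebra ℝ 𝔤] where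
  /-- The coefficients `J_r`. -/
  J : ℕ → M → Module.Dual ℝ 𝔤
  smooth : ∀ r ξ, ContMDiff 𝓘(ℝ, E) 𝓘(ℝ, ℝ) ∞ fun x => J r x ξ
  covariant : ∀ ξ η : 𝔤,
    S.mul ⟨fun r => component M (J r) (smooth r) ξ⟩ ⟨fun r => component M (J r) (smooth r) η⟩
      - S.mul ⟨fun r => component M (J r) (smooth r) η⟩ ⟨fun r => component M (J r) (smooth r) ξ⟩
    = (PowerSeries.C Complex.I * PowerSeries.X : PowerSeries ℂ) •
        (⟨fun r => component M (J r) (smooth r) ⁅ξ, η⁆⟩ : FormalSeries (Smooth E M))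

/-- `⟨J, ξ⟩ ∈ C^∞(M)[[λ]]`. -/
def QuantumMomentumMap.comp {S : StarProduct Ω} {𝔤 : Type*} [LieRing 𝔤] [LieAlgebra ℝ 𝔤]
    (Q : QuantumMomentumMap S 𝔤) (ξ : 𝔤) : FormalSeries (Smooth E M) :=
  ⟨fun r => component M (Q.J r) (Q.smooth r) ξ⟩

/-- `ι : C → M` is the (closed, regular) submanifold `J_0⁻¹(0)`, it is non-empty, and `0` is a
regular value of the classical momentum map `J_0 : M → 𝔤^*`, that is, `d_x J_0` is onto `𝔤^*`
whenever `J_0 x = 0`. -/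
structure QuantumMomentumMap.IsRegularConstraintSurface {S : StarProduct Ω}
    {𝔤 : Type*} [LieRing 𝔤] [LieAlgebra ℝ 𝔤] (Q : QuantumMomentumMap S 𝔤)
    {F : Type*} [NormedAddCommGroup F] [NormedSpace ℝ F]
    {C : Type*} [TopologicalSpace C] [ChartedSpace F C] (ι : C → M) : Prop where
  embedding : Manifold.IsSmoothEmbedding 𝓘(ℝ, F) 𝓘(ℝ, E) ∞ ι
  range_eq : Set.range ι = {x | Q.J 0 x = 0}
  nonempty : {x | Q.J 0 x = 0}.Nonempty
  regular : ∀ x, Q.J 0 x = 0 → ∀ β : Module.Dual ℝ 𝔤, ∃ v : TangentSpace 𝓘(ℝ, E) x,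
    ∀ ξ, mfderiv 𝓘(ℝ, E) 𝓘(ℝ, ℝ) (fun y => Q.J 0 y ξ) x v = β ξ

end Star

/-! ### Ghosts and antighosts -/

section Graded

variable (𝔤 : Type*) [LieRing 𝔤] [LieAlgebra ℝ 𝔤]

/-- `⋀ 𝔤^* ⊗ V`, for a complex vector space `V` (the factor `V`, on which `ℂ` acts, is written on
the left). -/
abbrev Ghost (V : Type*) [AddCommGroup V] [Module ℝ V] : Type _ :=
  V ⊗[ℝ] ExteriorAlgebra ℝ (Module.Dual ℝ 𝔤)

/-- `⋀ 𝔤 ⊗ A`, for a space `A` of functions. -/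
abbrev Antighost (A : Type*) [AddCommGroup A] [Module ℝ A] : Type _ :=
  A ⊗[ℝ] ExteriorAlgebra ℝ 𝔤

variable {V W : Type*} [AddCommGroup V] [Module ℝ V] [Module ℂ V] [IsScalarTower ℝ ℂ V]
  [AddCommGroup W] [Module ℝ W] [Module ℂ W] [IsScalarTower ℝ ℂ W]

/-- The extension of an operator `T` by `T (α ⊗ v) = (-1)^k α ⊗ T v` for `α ∈ ⋀^k 𝔤^*`. -/
def ghostExt (T : V →ₗ[ℂ] W) : Ghost 𝔤 V →ₗ[ℂ] Ghost 𝔤 W :=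
  TensorProduct.AlgebraTensorModule.map T
    (CliffordAlgebra.involute (Q := (0 : QuadraticForm ℝ (Module.Dual ℝ 𝔤)))).toLinearMap

/-- The same extension for operators between spaces of formal power series. -/
def ghostExtSeries (T : FormalSeries V →ₗ[PowerSeries ℂ] FormalSeries W) :
    FormalSeries (Ghost 𝔤 V) →ₗ[PowerSeries ℂ] FormalSeries (Ghost 𝔤 W) :=
  FormalSeries.ofCoeffs fun r => ghostExt 𝔤 (FormalSeries.opCoeff T r)

/-- The map `v ↦ α ⊗ v`. -/
def tensorGhost (V : Type*) [AddCommGroup V] [Module ℝ V] [Module ℂ V] [IsScalarTower ℝ ℂ V]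
    (α : ExteriorAlgebra ℝ (Module.Dual ℝ 𝔤)) : V →ₗ[ℂ] Ghost 𝔤 V :=
  (TensorProduct.AlgebraTensorModule.mk ℝ ℂ V (ExteriorAlgebra ℝ (Module.Dual ℝ 𝔤))).flip α

/-- `⋀ 𝔤^* ⊗ P ⊆ ⋀ 𝔤^* ⊗ V` for a subspace `P` of `V`. -/
def ghostSub (P : Submodule ℂ V) : Submodule ℂ (Ghost 𝔤 V) :=
  Submodule.span ℂ {w | ∃ α, ∃ v ∈ P, w = tensorGhost 𝔤 V α v}

/-- `⋀ 𝔤^* ⊗ N ⊆ (⋀ 𝔤^* ⊗ V)[[λ]]` for a `ℂ[[λ]]`-submodule `N` of `V[[λ]]`. -/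
def ghostSubSeries (N : Submodule (PowerSeries ℂ) (FormalSeries V)) :
    Submodule (PowerSeries ℂ) (FormalSeries (Ghost 𝔤 V)) :=
  Submodule.span (PowerSeries ℂ)
    {w | ∃ α, ∃ f ∈ N, w = FormalSeries.map (tensorGhost 𝔤 V α) f}

variable (A : Type*) [CommRing A] [Algebra ℂ A] [Algebra ℝ A] [IsScalarTower ℝ ℂ A]

/-- The part `⋀^i 𝔤 ⊗ A` of antighost degree `i`. -/
def antighostPart (i : ℕ) : Submodule ℂ (Antighost 𝔤 A) :=
  Submodule.span ℂ {w | ∃ x ∈ ⋀[ℝ]^i 𝔤, ∃ a : A, w = a ⊗ₜ[ℝ] x}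

variable {𝔤 A}

/-- `F ⊗ x ↦ D F ⊗ T x`. -/
def tmap (D : A →ₗ[ℂ] A) (T : ExteriorAlgebra ℝ 𝔤 →ₗ[ℝ] ExteriorAlgebra ℝ 𝔤) :
    Antighost 𝔤 A →ₗ[ℂ] Antighost 𝔤 A :=
  TensorProduct.AlgebraTensorModule.map D T

/-- The left insertion `i(β)` of `β ∈ 𝔤^*` into elements of `⋀ 𝔤`. -/
def insertion (β : Module.Dual ℝ 𝔤) : ExteriorAlgebra ℝ 𝔤 →ₗ[ℝ] ExteriorAlgebra ℝ 𝔤 :=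
  CliffordAlgebra.contractLeft (Q := (0 : QuadraticForm ℝ 𝔤)) β

variable (𝔤 A)

/-- The inclusion of `A` as antighost degree `0`. -/
def inc₀ : A →ₗ[ℂ] Antighost 𝔤 A :=
  (TensorProduct.AlgebraTensorModule.mk ℝ ℂ A (ExteriorAlgebra ℝ 𝔤)).flip 1

/-- The projection onto antighost degree `0`. -/
def pr₀ : Antighost 𝔤 A →ₗ[ℂ] A :=
  (TensorProduct.AlgebraTensorModule.rid ℝ ℂ A).toLinearMap ∘ₗ
    TensorProduct.AlgebraTensorModule.map LinearMap.id
      (ExteriorAlgebra.algebraMapInv : ExteriorAlgebra ℝ 𝔤 →ₐ[ℝ] ℝ).toLinearMap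

/-- The inclusion of `𝔤 ⊗ A` as antighost degree `1`. -/
def inc₁ : A ⊗[ℝ] 𝔤 →ₗ[ℂ] Antighost 𝔤 A :=
  TensorProduct.AlgebraTensorModule.map LinearMap.id (ExteriorAlgebra.ι ℝ)

/-- The projection onto antighost degree `1`. -/
def pr₁ : Antighost 𝔤 A →ₗ[ℂ] A ⊗[ℝ] 𝔤 :=
  TensorProduct.AlgebraTensorModule.map LinearMap.id ExteriorAlgebra.ιInv

end Graded

/-! ### The Koszul complex and its quantisation -/

section Koszul

variable {E : Type*} [NormedAddCommGroup E] [NormedSpace ℝ E] [FiniteDimensional ℝ E]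
  {M : Type*} [TopologicalSpace M] [ChartedSpace E M]
  {Ω : SymplecticForm E M} {S : StarProduct Ω}
  {𝔤 : Type*} [LieRing 𝔤] [LieAlgebra ℝ 𝔤] [FiniteDimensional ℝ 𝔤]
  (Q : QuantumMomentumMap S 𝔤)

/-- The Koszul operator `∂ = i(J_0) = ∑_a ⟨J_0, e_a⟩ i(e^a)` on `⋀ 𝔤 ⊗ C^∞(M)`. -/
def koszul : Antighost 𝔤 (Smooth E M) →ₗ[ℂ] Antighost 𝔤 (Smooth E M) :=
  ∑ a, tmap (LinearMap.mulLeft ℂ ((Q.comp (Module.finBasis ℝ 𝔤 a)).coeff 0))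
    (insertion ((Module.finBasis ℝ 𝔤).coord a))

/-- The operator `F ⊗ x ↦ ∑_a (F * J_a) ⊗ i(e^a) x`. -/
def rightMul : FormalSeries (Antighost 𝔤 (Smooth E M)) →ₗ[PowerSeries ℂ]
    FormalSeries (Antighost 𝔤 (Smooth E M)) :=
  FormalSeries.ofCoeffs fun r =>
    ∑ a, tmap (S.rightCoeff (Q.comp (Module.finBasis ℝ 𝔤 a)) r)
      (insertion ((Module.finBasis ℝ 𝔤).coord a))

variable (𝔤) (A : Type*) [CommRing A] [Algebra ℂ A] [Algebra ℝ A] [IsScalarTower ℝ ℂ A]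

/-- The linear form `ξ ↦ tr (ad ξ)` on `𝔤`. -/
def traceAd : Module.Dual ℝ 𝔤 :=
  LinearMap.trace ℝ 𝔤 ∘ₗ
    LinearMap.mk₂ ℝ (fun ξ η : 𝔤 => ⁅ξ, η⁆) add_lie smul_lie lie_add lie_smul

/-- The operator `u`: insertion of the linear form `ξ ↦ tr (ad ξ)`. -/
def opU : Antighost 𝔤 A →ₗ[ℂ] Antighost 𝔤 A :=
  tmap LinearMap.id (insertion (traceAd 𝔤))

/-- The operator `q = -1/2 ∑_{a,b} [e_a, e_b] ∧ i(e^a) i(e^b)`, that is,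
`q (ξ_1 ∧ … ∧ ξ_l) = ∑_{i<j} (-1)^{i+j-1} [ξ_i, ξ_j] ∧ ξ_1 ∧ … (omit ξ_i, ξ_j) … ∧ ξ_l`. -/
def opQ : Antighost 𝔤 A →ₗ[ℂ] Antighost 𝔤 A :=
  tmap LinearMap.id ((-1 / 2 : ℝ) • ∑ a, ∑ b,
    LinearMap.mulLeft ℝ (ExteriorAlgebra.ι ℝ ⁅Module.finBasis ℝ 𝔤 a, Module.finBasis ℝ 𝔤 b⁆) ∘ₗ
      insertion ((Module.finBasis ℝ 𝔤).coord a) ∘ₗ insertion ((Module.finBasis ℝ 𝔤).coord b))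

variable {𝔤}

/-- The quantised Koszul operator `∂̂`, equal to `F ⊗ x ↦ ∑_a (F * J_a) ⊗ i(e^a) x` plus
`iλ (u / 2 - q)`. -/
def qKoszul : FormalSeries (Antighost 𝔤 (Smooth E M)) →ₗ[PowerSeries ℂ]
    FormalSeries (Antighost 𝔤 (Smooth E M)) :=
  rightMul Q + (PowerSeries.C Complex.I * PowerSeries.X : PowerSeries ℂ) •
    FormalSeries.map ((1 / 2 : ℂ) • opU 𝔤 (Smooth E M) - opQ 𝔤 (Smooth E M))

/-- `∂_1 : 𝔤 ⊗ C^∞(M) → C^∞(M)`. -/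
def koszul₁ : Smooth E M ⊗[ℝ] 𝔤 →ₗ[ℂ] Smooth E M :=
  pr₀ 𝔤 (Smooth E M) ∘ₗ koszul Q ∘ₗ inc₁ 𝔤 (Smooth E M)

/-- `∂̂_1 : (𝔤 ⊗ C^∞(M))[[λ]] → C^∞(M)[[λ]]`. -/
def qKoszul₁ : FormalSeries (Smooth E M ⊗[ℝ] 𝔤) →ₗ[PowerSeries ℂ] FormalSeries (Smooth E M) :=
  FormalSeries.map (pr₀ 𝔤 (Smooth E M)) ∘ₗ qKoszul Q ∘ₗ FormalSeries.map (inc₁ 𝔤 (Smooth E M))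

/-- The quantum vanishing ideal `∂̂_1 (𝔤 ⊗ C^∞(M)[[λ]])` of the constraint surface. -/
def quantumIdeal : Submodule (PowerSeries ℂ) (FormalSeries (Smooth E M)) :=
  LinearMap.range (qKoszul₁ Q)

variable {F : Type*} [NormedAddCommGroup F] [NormedSpace ℝ F]
  {C : Type*} [TopologicalSpace C] [ChartedSpace F C]

/-- `(prol, h)` is a chain homotopy of the augmented Koszul complex
`0 ← C^∞(C) ← C^∞(M) ← 𝔤 ⊗ C^∞(M) ← ⋀² 𝔤 ⊗ C^∞(M) ← …` with `h₀ ∘ prol = 0`. -/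
structure IsKoszulHomotopy (res : Smooth E M →ₗ[ℂ] Smooth F C)
    (prol : Smooth F C →ₗ[ℂ] Smooth E M)
    (h : Antighost 𝔤 (Smooth E M) →ₗ[ℂ] Antighost 𝔤 (Smooth E M)) : Prop where
  degree : ∀ i, ∀ w ∈ antighostPart 𝔤 (Smooth E M) i, h w ∈ antighostPart 𝔤 (Smooth E M) (i + 1)
  res_prol : res ∘ₗ prol = LinearMap.id
  homotopy_zero : ∀ f : Smooth E M,
    inc₀ 𝔤 _ (prol (res f)) + koszul Q (h (inc₀ 𝔤 _ f)) = inc₀ 𝔤 _ f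
  homotopy_pos : ∀ i, ∀ w ∈ antighostPart 𝔤 (Smooth E M) (i + 1),
    h (koszul Q w) + koszul Q (h w) = w
  h_prol : ∀ φ, h (inc₀ 𝔤 _ (prol φ)) = 0

/-- `h₀ : C^∞(M) → 𝔤 ⊗ C^∞(M)`. -/
def homotopy₀ (h : Antighost 𝔤 (Smooth E M) →ₗ[ℂ] Antighost 𝔤 (Smooth E M)) :
    Smooth E M →ₗ[ℂ] Smooth E M ⊗[ℝ] 𝔤 :=
  pr₁ 𝔤 (Smooth E M) ∘ₗ h ∘ₗ inc₀ 𝔤 (Smooth E M)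

/-! The following operators act on the ghost-extended spaces `(⋀ 𝔤^* ⊗ V)[[λ]]`. -/

variable (𝔤) in
/-- The `λ`-linear extension of `α ⊗ v ↦ (-1)^k α ⊗ T v` to `(⋀ 𝔤^* ⊗ V)[[λ]]`. -/
def ghostMap {V W : Type*} [AddCommGroup V] [Module ℝ V] [Module ℂ V] [IsScalarTower ℝ ℂ V]
    [AddCommGroup W] [Module ℝ W] [Module ℂ W] [IsScalarTower ℝ ℂ W] (T : V →ₗ[ℂ] W) :
    FormalSeries (Ghost 𝔤 V) →ₗ[PowerSeries ℂ] FormalSeries (Ghost 𝔤 W) :=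
  FormalSeries.map (ghostExt 𝔤 T)

/-- `B₁ = (1 / λ) (∂_1 - ∂̂_1)`. -/
def opB₁ : FormalSeries (Ghost 𝔤 (Smooth E M ⊗[ℝ] 𝔤)) →ₗ[PowerSeries ℂ]
    FormalSeries (Ghost 𝔤 (Smooth E M)) :=
  FormalSeries.divLambda (ghostMap 𝔤 (koszul₁ Q) - ghostExtSeries 𝔤 (qKoszul₁ Q))

/-- `id₀ - λ B₁ h₀`. -/
def perturbation (h : Antighost 𝔤 (Smooth E M) →ₗ[ℂ] Antighost 𝔤 (Smooth E M)) :
    Module.End (PowerSeries ℂ) (FormalSeries (Ghost 𝔤 (Smooth E M))) :=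
  1 - (PowerSeries.X : PowerSeries ℂ) • (opB₁ Q ∘ₗ ghostMap 𝔤 (homotopy₀ h))

/-- The deformed restriction `ι^* (id₀ - λ B₁ h₀)⁻¹` (meaningful when the operator is
invertible). -/
def qRestriction (res : Smooth E M →ₗ[ℂ] Smooth F C)
    (h : Antighost 𝔤 (Smooth E M) →ₗ[ℂ] Antighost 𝔤 (Smooth E M)) :
    FormalSeries (Ghost 𝔤 (Smooth E M)) →ₗ[PowerSeries ℂ] FormalSeries (Ghost 𝔤 (Smooth F C)) :=
  ghostMap 𝔤 res ∘ₗ Ring.inverse (perturbation Q h)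

end Koszul

end BRST

end

/-!
The proof is the homological perturbation lemma, carried out in the lowest degrees.

Because `prol ι^* + ∂_1 h_0 = id`, the operator `id - λ B_1 h_0` equals `prol ι^* + ∂̂_1 h_0`
(`IsKoszulHomotopy.perturbation_eq`). It is of the form `id - λ T`, hence invertible by a Neumann
series (`FormalSeries.isUnit_one_sub_X_smul`), and the deformed restriction is characterised by
`ι_q^* (prol ι^* + ∂̂_1 h_0) = ι^*`. This gives at once uniqueness, since any `R` with `R ∂̂_1 = 0`
and `R prol = id` satisfies the same equation; `ι_q^* prol = id`, since `h_0 prol = 0`; and the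
inclusion of the kernel of `ι_q^*` in the image of `∂̂_1`, since
`y = (prol ι^* + ∂̂_1 h_0) z` with `ι^* z = 0` is `∂̂_1 h_0 z`.

The one property that needs the quantum momentum map is `ι_q^* ∂̂_1 = 0`. It rests on
`∂̂_1 ∂̂_2 = 0` (`qKoszul₁_qKoszul`), which follows from the associativity of the star product, the
commutation relation of `J`, and `tr (ad [ξ, η]) = 0`. From `id = h_0 ∂_1 + ∂_2 h_1` one sees that
`U = h_0 ∂_1 + ∂̂_2 h_1` is the identity modulo `λ`, hence invertible, and
`∂̂_1 U = ∂̂_1 h_0 ∂_1 = (prol ι^* + ∂̂_1 h_0) ∂_1`, because `ι^* ∂_1 = 0`. Therefore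
`ι_q^* ∂̂_1 U = ι^* ∂_1 = 0`.

A `ℂ[[λ]]`-linear map between spaces of formal power series is determined by its values on constant
series (`FormalSeries.linearMap_ext`), so identities between such maps, including those on the
ghost-extended spaces, are checked on `α ⊗ f` with `α ∈ ⋀ 𝔤^*` (`ghostSeries_ext`). That the kernel
is `⋀ 𝔤^* ⊗ 𝔍_C`, with no completion of the tensor product, uses that `⋀ 𝔤^*` is
finite-dimensional (`exists_eq_sum_map_tensorGhost`).
-/

namespace BRST

/-! ### Linear maps between spaces of formal power series -/

namespace FormalSeries

section
variable {V : Type*} [AddCommGroup V]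

theorem coeff_sub (f g : FormalSeries V) (n : ℕ) :
    (f - g).coeff n = f.coeff n - g.coeff n := by
  rw [sub_eq_add_neg, coeff_add, coeff_neg, sub_eq_add_neg]

theorem coeff_sum {ι : Type*} (s : Finset ι) (f : ι → FormalSeries V) (n : ℕ) :
    (∑ i ∈ s, f i).coeff n = ∑ i ∈ s, (f i).coeff n := by
  classical
  induction s using Finset.induction_on with
  | empty => simp
  | insert a s ha ih => rw [Finset.sum_insert ha, Finset.sum_insert ha, coeff_add, ih]

theorem coeff_const (v : V) (n : ℕ) : (const v).coeff n = if n = 0 then v else 0 := rfl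

end

variable {V W Z : Type*} [AddCommGroup V] [Module ℂ V] [AddCommGroup W] [Module ℂ W]
  [AddCommGroup Z] [Module ℂ Z]

theorem coeff_X_pow_smul (k : ℕ) (f : FormalSeries V) (n : ℕ) :
    ((PowerSeries.X ^ k : PowerSeries ℂ) • f).coeff n = if k ≤ n then f.coeff (n - k) else 0 := by
  rw [coeff_smul]
  split_ifs with hk
  · rw [Finset.sum_eq_single (k, n - k)]
    · simp [PowerSeries.coeff_X_pow]
    · rintro ⟨i, j⟩ hp hne
      have hi : i ≠ k := by
        rintro rfl
        simp only [Finset.HasAntidiagonal.mem_antidiagonal] at hp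
        exact hne (by simp; omega)
      simp [PowerSeries.coeff_X_pow, hi]
    · intro hn
      simp only [Finset.HasAntidiagonal.mem_antidiagonal] at hn
      omega
  · refine Finset.sum_eq_zero ?_
    rintro ⟨i, j⟩ hp
    simp only [Finset.HasAntidiagonal.mem_antidiagonal] at hp
    have hi : i ≠ k := by omega
    simp [PowerSeries.coeff_X_pow, hi]

theorem coeff_X_smul_zero (f : FormalSeries V) :
    ((PowerSeries.X : PowerSeries ℂ) • f).coeff 0 = 0 := by
  simpa using coeff_X_pow_smul 1 f 0

theorem coeff_X_smul_succ (f : FormalSeries V) (n : ℕ) :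
    ((PowerSeries.X : PowerSeries ℂ) • f).coeff (n + 1) = f.coeff n := by
  simpa using coeff_X_pow_smul 1 f (n + 1)

theorem coeff_ofCoeffs (T : ℕ → V →ₗ[ℂ] W) (f : FormalSeries V) (n : ℕ) :
    (ofCoeffs T f).coeff n = ∑ p ∈ antidiagonal n, T p.1 (f.coeff p.2) := rfl

theorem coeff_ofCoeffs_const (T : ℕ → V →ₗ[ℂ] W) (v : V) (n : ℕ) :
    (ofCoeffs T (const v)).coeff n = T n v := by
  rw [coeff_ofCoeffs, Finset.sum_eq_single (n, 0)]
  · simp [coeff_const]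
  · rintro ⟨i, j⟩ hp hne
    have hj : j ≠ 0 := by
      rintro rfl
      simp at hp
      exact hne (by simp [hp])
    simp [coeff_const, hj]
  · intro h
    simp at h

theorem coeff_map (T : V →ₗ[ℂ] W) (f : FormalSeries V) (n : ℕ) :
    (map T f).coeff n = T (f.coeff n) := by
  rw [map, coeff_ofCoeffs, Finset.sum_eq_single (0, n)]
  · simp
  · rintro ⟨i, j⟩ hp hne
    have hi : i ≠ 0 := by
      rintro rfl
      simp at hp
      exact hne (by simp [hp])
    simp [hi]
  · intro h
    simp at h

theorem map_const (T : V →ₗ[ℂ] W) (v : V) : map T (const v) = const (T v) := by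
  ext n
  rw [coeff_map, coeff_const, coeff_const]
  split_ifs <;> simp

theorem map_map (T : W →ₗ[ℂ] Z) (S : V →ₗ[ℂ] W) (f : FormalSeries V) :
    map T (map S f) = map (T ∘ₗ S) f := by
  ext n; simp [coeff_map]

theorem map_id (f : FormalSeries V) : map LinearMap.id f = f := by
  ext n; simp [coeff_map]

theorem map_zero_left (f : FormalSeries V) : map (0 : V →ₗ[ℂ] W) f = 0 := by
  ext n; simp [coeff_map]

theorem map_add_left (T S : V →ₗ[ℂ] W) (f : FormalSeries V) :
    map (T + S) f = map T f + map S f := by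
  ext n; simp [coeff_map]

theorem map_sub_left (T S : V →ₗ[ℂ] W) (f : FormalSeries V) :
    map (T - S) f = map T f - map S f := by
  ext n; simp [coeff_map, coeff_sub]

theorem map_smul_left (c : ℂ) (T : V →ₗ[ℂ] W) (f : FormalSeries V) :
    map (c • T) f = PowerSeries.C c • map T f := by
  ext n; rw [coeff_C_smul]; simp [coeff_map]

theorem opCoeff_apply (T : FormalSeries V →ₗ[PowerSeries ℂ] FormalSeries W) (r : ℕ) (v : V) :
    opCoeff T r v = (T (const v)).coeff r := rfl

theorem opCoeff_ofCoeffs (T : ℕ → V →ₗ[ℂ] W) (r : ℕ) : opCoeff (ofCoeffs T) r = T r := by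
  ext v; rw [opCoeff_apply, coeff_ofCoeffs_const]

/-- A `ℂ[[λ]]`-linear map commutes with multiplication by powers of `λ`, so it is continuous for
the `λ`-adic topology: its values modulo `λ ^ (n + 1)` depend on the argument modulo
`λ ^ (n + 1)` only. -/
theorem coeff_congr (T : FormalSeries V →ₗ[PowerSeries ℂ] FormalSeries W) {f g : FormalSeries V}
    {n : ℕ} (h : ∀ m ≤ n, f.coeff m = g.coeff m) : ∀ m ≤ n, (T f).coeff m = (T g).coeff m := by
  intro m hm
  have key : f - g = (PowerSeries.X ^ (n + 1) : PowerSeries ℂ) •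
      (⟨fun k => (f - g).coeff (k + (n + 1))⟩ : FormalSeries V) := by
    ext k
    rw [coeff_X_pow_smul]
    split_ifs with hk
    · simp [Nat.sub_add_cancel hk]
    · rw [coeff_sub, h k (by omega), sub_self]
  rw [← sub_eq_zero, ← coeff_sub, ← map_sub, key, map_smul, coeff_X_pow_smul,
    if_neg (by omega)]

/-- A `ℂ[[λ]]`-linear map between spaces of formal power series is determined by its values on
constant series. -/
theorem linearMap_ext {T S : FormalSeries V →ₗ[PowerSeries ℂ] FormalSeries W}
    (h : ∀ v, T (const v) = S (const v)) : T = S := by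
  ext f n
  -- Modulo `λ ^ (n + 1)`, the series `f` is a polynomial `g` with constant coefficients.
  let g : FormalSeries V :=
    ∑ k ∈ Finset.range (n + 1), (PowerSeries.X ^ k : PowerSeries ℂ) • const (f.coeff k)
  have hg : ∀ m ≤ n, f.coeff m = g.coeff m := by
    intro m hm
    rw [coeff_sum, Finset.sum_eq_single m]
    · simp [coeff_X_pow_smul, coeff_const]
    · intro k _ hk
      rw [coeff_X_pow_smul]
      split_ifs with hkm
      · rw [coeff_const, if_neg (by omega)]
      · rfl
    · intro hm'
      simp at hm'
      omega
  rw [coeff_congr T hg n le_rfl, coeff_congr S hg n le_rfl]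
  simp only [g, map_sum, map_smul, h]

theorem ofCoeffs_opCoeff (T : FormalSeries V →ₗ[PowerSeries ℂ] FormalSeries W) :
    ofCoeffs (opCoeff T) = T :=
  linearMap_ext fun v => by ext n; rw [coeff_ofCoeffs_const, opCoeff_apply]

theorem coeff_zero_apply (T : FormalSeries V →ₗ[PowerSeries ℂ] FormalSeries W)
    (f : FormalSeries V) : (T f).coeff 0 = opCoeff T 0 (f.coeff 0) := by
  conv_lhs => rw [← ofCoeffs_opCoeff T]
  simp [coeff_ofCoeffs]

theorem opCoeff_zero_comp (T : FormalSeries W →ₗ[PowerSeries ℂ] FormalSeries Z)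
    (S : FormalSeries V →ₗ[PowerSeries ℂ] FormalSeries W) :
    opCoeff (T ∘ₗ S) 0 = opCoeff T 0 ∘ₗ opCoeff S 0 := by
  ext v
  simp [opCoeff_apply (T ∘ₗ S), coeff_zero_apply, coeff_const]

theorem opCoeff_map_zero (T : V →ₗ[ℂ] W) : opCoeff (map T) 0 = T := by
  rw [map, opCoeff_ofCoeffs, if_pos rfl]

theorem X_smul_divLambda {T : FormalSeries V →ₗ[PowerSeries ℂ] FormalSeries W}
    (h : opCoeff T 0 = 0) : (PowerSeries.X : PowerSeries ℂ) • divLambda T = T := by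
  refine linearMap_ext fun v => ?_
  ext n
  rw [LinearMap.smul_apply]
  cases n with
  | zero => rw [coeff_X_smul_zero, ← opCoeff_apply, h, LinearMap.zero_apply]
  | succ n => rw [coeff_X_smul_succ, divLambda, coeff_ofCoeffs_const, opCoeff_apply]

/-- The Neumann series `∑ λ ^ k T ^ k` inverts `id - λ T`. -/
theorem isUnit_one_sub_X_smul (T : Module.End (PowerSeries ℂ) (FormalSeries V)) :
    IsUnit (1 - (PowerSeries.X : PowerSeries ℂ) • T) := by
  set N : Module.End (PowerSeries ℂ) (FormalSeries V) := (PowerSeries.X : PowerSeries ℂ) • T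
  have hN : ∀ (k n : ℕ) (f : FormalSeries V), n < k → ((N ^ k) f).coeff n = 0 := by
    intro k n f hk
    rw [smul_pow, LinearMap.smul_apply, coeff_X_pow_smul, if_neg (by omega)]
  rw [Module.End.isUnit_iff]
  constructor
  · rw [injective_iff_map_eq_zero]
    intro f hf
    have h1 : N f = f := by
      rw [LinearMap.sub_apply, Module.End.one_apply, sub_eq_zero] at hf
      exact hf.symm
    -- An element of the kernel satisfies `f = N ^ k f`, so it is divisible by every power of `λ`.
    have hk : ∀ k : ℕ, (N ^ k) f = f := by
      intro k
      induction k with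
      | zero => simp
      | succ k ih => rw [pow_succ, Module.End.mul_apply, h1, ih]
    ext n
    rw [← hk (n + 1), hN _ _ _ (Nat.lt_succ_self n), coeff_zero]
  · intro g
    let S : ℕ → Module.End (PowerSeries ℂ) (FormalSeries V) :=
      fun n => ∑ k ∈ Finset.range (n + 1), N ^ k
    -- The partial sums of the Neumann series stabilise in each degree, so their diagonal is its sum.
    let f : FormalSeries V := ⟨fun n => (S n g).coeff n⟩
    have hS : ∀ n m, m ≤ n → (S m g).coeff m = (S n g).coeff m := by
      intro n m hm
      simp only [S, LinearMap.sum_apply, coeff_sum]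
      refine Finset.sum_subset (by simpa using hm) fun k _ hk => ?_
      exact hN _ _ _ (by simp at hk; omega)
    refine ⟨f, ?_⟩
    ext n
    rw [coeff_congr (1 - N) (f := f) (g := S n g) (n := n) (fun m hm => hS n m hm) n le_rfl,
      ← Module.End.mul_apply, mul_neg_geom_sum, LinearMap.sub_apply, coeff_sub,
      hN _ _ _ (Nat.lt_succ_self n), sub_zero, Module.End.one_apply]

theorem isUnit_of_opCoeff_zero {T : Module.End (PowerSeries ℂ) (FormalSeries V)}
    (h : opCoeff T 0 = LinearMap.id) : IsUnit T := by
  have h0 : opCoeff (1 - T) 0 = 0 := by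
    ext v
    rw [opCoeff_apply, LinearMap.sub_apply, coeff_sub, ← opCoeff_apply T, h]
    simp [coeff_const]
  have := isUnit_one_sub_X_smul (divLambda (1 - T))
  rwa [X_smul_divLambda h0, sub_sub_cancel] at this

theorem range_map (T : V →ₗ[ℂ] W) :
    LinearMap.range (map T) = sub (LinearMap.range T) := by
  ext f
  constructor
  · rintro ⟨g, rfl⟩ n
    exact ⟨g.coeff n, (coeff_map T g n).symm⟩
  · intro hf
    choose g hg using hf
    exact ⟨⟨g⟩, by ext n; rw [coeff_map]; exact hg n⟩

end FormalSeries

/-! ### Operators on ghost-extended spaces -/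

section Ghost

variable {𝔤 : Type*} [LieRing 𝔤] [LieAlgebra ℝ 𝔤]
  {V W Z : Type*} [AddCommGroup V] [Module ℝ V] [Module ℂ V] [IsScalarTower ℝ ℂ V]
  [AddCommGroup W] [Module ℝ W] [Module ℂ W] [IsScalarTower ℝ ℂ W]
  [AddCommGroup Z] [Module ℂ Z]

theorem tensorGhost_apply (α : ExteriorAlgebra ℝ (Module.Dual ℝ 𝔤)) (v : V) :
    tensorGhost 𝔤 V α v = v ⊗ₜ[ℝ] α := rfl

/-- The parity involution `α ↦ (-1)^k α` of `⋀ 𝔤^*`. -/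
noncomputable abbrev parity (α : ExteriorAlgebra ℝ (Module.Dual ℝ 𝔤)) :
    ExteriorAlgebra ℝ (Module.Dual ℝ 𝔤) :=
  CliffordAlgebra.involute (Q := (0 : QuadraticForm ℝ (Module.Dual ℝ 𝔤))) α

theorem ghostExt_tmul (T : V →ₗ[ℂ] W) (v : V) (α : ExteriorAlgebra ℝ (Module.Dual ℝ 𝔤)) :
    ghostExt 𝔤 T (v ⊗ₜ[ℝ] α) = T v ⊗ₜ[ℝ] parity α := rfl

/-- Two `ℂ[[λ]]`-linear maps on `(⋀ 𝔤^* ⊗ V)[[λ]]` agree if they agree on every `α ⊗ f` with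
`α ∈ ⋀ 𝔤^*` and `f ∈ V[[λ]]`. -/
theorem ghostSeries_ext {T S : FormalSeries (Ghost 𝔤 V) →ₗ[PowerSeries ℂ] FormalSeries Z}
    (h : ∀ α f, T (FormalSeries.map (tensorGhost 𝔤 V α) f)
      = S (FormalSeries.map (tensorGhost 𝔤 V α) f)) : T = S := by
  refine FormalSeries.linearMap_ext fun w => ?_
  have key : ∀ n, FormalSeries.opCoeff T n = FormalSeries.opCoeff S n := by
    intro n
    refine LinearMap.ext fun w => ?_
    induction w using TensorProduct.induction_on with
    | zero => simp
    | tmul v α =>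
      have := h α (FormalSeries.const v)
      rw [FormalSeries.map_const, tensorGhost_apply] at this
      rw [FormalSeries.opCoeff_apply, FormalSeries.opCoeff_apply, this]
    | add x y hx hy => rw [map_add, map_add, hx, hy]
  ext n
  exact LinearMap.congr_fun (key n) w

theorem ghostExtSeries_map_tensorGhost
    (T : FormalSeries V →ₗ[PowerSeries ℂ] FormalSeries W)
    (α : ExteriorAlgebra ℝ (Module.Dual ℝ 𝔤)) (f : FormalSeries V) :
    ghostExtSeries 𝔤 T (FormalSeries.map (tensorGhost 𝔤 V α) f)
      = FormalSeries.map (tensorGhost 𝔤 W (parity α)) (T f) := by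
  suffices h : ghostExtSeries 𝔤 T ∘ₗ FormalSeries.map (tensorGhost 𝔤 V α)
      = FormalSeries.map (tensorGhost 𝔤 W (parity α)) ∘ₗ T from LinearMap.congr_fun h f
  refine FormalSeries.linearMap_ext fun v => ?_
  ext n
  rw [LinearMap.comp_apply, LinearMap.comp_apply, FormalSeries.map_const, ghostExtSeries,
    FormalSeries.coeff_ofCoeffs_const, FormalSeries.coeff_map, tensorGhost_apply, ghostExt_tmul,
    tensorGhost_apply, FormalSeries.opCoeff_apply]

theorem ghostMap_map_tensorGhost (T : V →ₗ[ℂ] W)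
    (α : ExteriorAlgebra ℝ (Module.Dual ℝ 𝔤)) (f : FormalSeries V) :
    ghostMap 𝔤 T (FormalSeries.map (tensorGhost 𝔤 V α) f)
      = FormalSeries.map (tensorGhost 𝔤 W (parity α)) (FormalSeries.map T f) := by
  rw [ghostMap, FormalSeries.map_map, FormalSeries.map_map]
  rfl

theorem parity_parity (α : ExteriorAlgebra ℝ (Module.Dual ℝ 𝔤)) : parity (parity α) = α :=
  CliffordAlgebra.involute_involute _

theorem opCoeff_zero_ghostExtSeries (T : FormalSeries V →ₗ[PowerSeries ℂ] FormalSeries W) :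
    FormalSeries.opCoeff (ghostExtSeries 𝔤 T) 0 = ghostExt 𝔤 (FormalSeries.opCoeff T 0) := by
  rw [ghostExtSeries, FormalSeries.opCoeff_ofCoeffs]

theorem range_ghostExt (T : V →ₗ[ℂ] W) :
    LinearMap.range (ghostExt 𝔤 T) = ghostSub 𝔤 (LinearMap.range T) := by
  apply le_antisymm
  · rintro _ ⟨w, rfl⟩
    induction w using TensorProduct.induction_on with
    | zero => simp
    | tmul v α =>
      exact Submodule.subset_span ⟨parity α, T v, ⟨v, rfl⟩, ghostExt_tmul T v α⟩
    | add x y hx hy => rw [map_add]; exact add_mem hx hy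
  · refine Submodule.span_le.2 ?_
    rintro _ ⟨α, _, ⟨v, rfl⟩, rfl⟩
    exact ⟨v ⊗ₜ[ℝ] parity α, by rw [ghostExt_tmul, parity_parity]; rfl⟩

instance finite_exteriorAlgebra_dual [FiniteDimensional ℝ 𝔤] :
    Module.Finite ℝ (ExteriorAlgebra ℝ (Module.Dual ℝ 𝔤)) :=
  Module.Finite.of_basis (Module.finBasis ℝ (Module.Dual ℝ 𝔤)).ExteriorAlgebra

/-- Since `⋀ 𝔤^*` is finite-dimensional, every formal power series with values in `⋀ 𝔤^* ⊗ V` is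
a finite sum `∑ α_i ⊗ f_i` with `f_i ∈ V[[λ]]`. -/
theorem exists_eq_sum_map_tensorGhost [FiniteDimensional ℝ 𝔤] (g : FormalSeries (Ghost 𝔤 V)) :
    ∃ (n : ℕ) (α : Fin n → ExteriorAlgebra ℝ (Module.Dual ℝ 𝔤)) (f : Fin n → FormalSeries V),
      g = ∑ i, FormalSeries.map (tensorGhost 𝔤 V (α i)) (f i) := by
  let b := Module.finBasis ℝ (ExteriorAlgebra ℝ (Module.Dual ℝ 𝔤))
  have key : ∀ w : Ghost 𝔤 V, ∃ v : Fin _ → V, w = ∑ i, v i ⊗ₜ[ℝ] b i := by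
    intro w
    induction w using TensorProduct.induction_on with
    | zero => exact ⟨0, by simp⟩
    | tmul v α =>
      refine ⟨fun i => b.repr α i • v, ?_⟩
      conv_lhs => rw [← b.sum_repr α, TensorProduct.tmul_sum]
      simp only [TensorProduct.tmul_smul, TensorProduct.smul_tmul']
    | add x y hx hy =>
      obtain ⟨v, rfl⟩ := hx
      obtain ⟨v', rfl⟩ := hy
      exact ⟨v + v', by simp [TensorProduct.add_tmul, Finset.sum_add_distrib]⟩
  choose v hv using fun n => key (g.coeff n)
  refine ⟨_, b, fun i => ⟨fun n => v n i⟩, ?_⟩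
  ext n
  rw [hv n, FormalSeries.coeff_sum]
  refine Finset.sum_congr rfl fun i _ => ?_
  rw [FormalSeries.coeff_map, tensorGhost_apply]

theorem range_ghostExtSeries [FiniteDimensional ℝ 𝔤]
    (T : FormalSeries V →ₗ[PowerSeries ℂ] FormalSeries W) :
    LinearMap.range (ghostExtSeries 𝔤 T) = ghostSubSeries 𝔤 (LinearMap.range T) := by
  apply le_antisymm
  · rintro _ ⟨g, rfl⟩
    obtain ⟨n, α, f, rfl⟩ := exists_eq_sum_map_tensorGhost g
    rw [map_sum]
    refine Submodule.sum_mem _ fun i _ => ?_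
    exact Submodule.subset_span ⟨_, _, ⟨f i, rfl⟩, ghostExtSeries_map_tensorGhost T (α i) (f i)⟩
  · refine Submodule.span_le.2 ?_
    rintro _ ⟨α, _, ⟨f, rfl⟩, rfl⟩
    exact ⟨FormalSeries.map (tensorGhost 𝔤 V (parity α)) f, by
      rw [ghostExtSeries_map_tensorGhost, parity_parity]⟩

end Ghost

/-! ### The star product on formal power series -/

section Star

open FormalSeries

variable {E : Type*} [NormedAddCommGroup E] [NormedSpace ℝ E] [FiniteDimensional ℝ E]
  {M : Type*} [TopologicalSpace M] [ChartedSpace E M]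
  {Ω : SymplecticForm E M} (S : StarProduct Ω)

/-- The coefficient of `λ ^ n` in the operator `g ↦ f * g` on `C^∞(M)[[λ]]`. -/
noncomputable def StarProduct.leftCoeff (f : FormalSeries (Smooth E M)) (n : ℕ) :
    Smooth E M →ₗ[ℂ] Smooth E M :=
  ∑ p ∈ antidiagonal n, S.C p.1 (f.coeff p.2)

theorem StarProduct.mul_eq_leftCoeff (f g : FormalSeries (Smooth E M)) :
    S.mul f g = ofCoeffs (S.leftCoeff f) g := by
  ext1
  funext n
  simp only [StarProduct.mul, coeff_ofCoeffs, StarProduct.rightCoeff, StarProduct.leftCoeff,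
    LinearMap.sum_apply, LinearMap.flip_apply]
  rw [Finset.sum_sigma', Finset.sum_sigma']
  refine Finset.sum_nbij' (fun x => ⟨(x.2.1 + x.1.2, x.2.2), (x.2.1, x.1.2)⟩)
    (fun x => ⟨(x.2.1 + x.1.2, x.2.2), (x.2.1, x.1.2)⟩) ?_ ?_ ?_ ?_ ?_ <;>
  · rintro ⟨⟨i, j⟩, ⟨k, l⟩⟩ h
    simp only [Finset.mem_sigma, Finset.HasAntidiagonal.mem_antidiagonal] at h ⊢
    try obtain ⟨h1, h2⟩ := h
    try subst h2
    try subst h1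
    try simp [add_right_comm]

/-- The star product as a bilinear map over `ℂ[[λ]]`. -/
noncomputable def StarProduct.mulLinear : FormalSeries (Smooth E M) →ₗ[PowerSeries ℂ]
    FormalSeries (Smooth E M) →ₗ[PowerSeries ℂ] FormalSeries (Smooth E M) :=
  LinearMap.mk₂ (PowerSeries ℂ) S.mul
    (fun f f' g => by simp only [StarProduct.mul, map_add])
    (fun c f g => by simp only [StarProduct.mul, map_smul])
    (fun f g g' => by simp only [S.mul_eq_leftCoeff, map_add])
    (fun c f g => by simp only [S.mul_eq_leftCoeff, map_smul])

theorem StarProduct.mulLinear_apply (f g : FormalSeries (Smooth E M)) :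
    S.mulLinear f g = S.mul f g := rfl

theorem StarProduct.coeff_mul_const (f : FormalSeries (Smooth E M)) (g : Smooth E M) (n : ℕ) :
    (S.mul f (const g)).coeff n = ∑ p ∈ antidiagonal n, S.C p.1 (f.coeff p.2) g := by
  rw [S.mul_eq_leftCoeff, coeff_ofCoeffs_const, StarProduct.leftCoeff, LinearMap.sum_apply]

theorem StarProduct.coeff_const_mul (f : Smooth E M) (g : FormalSeries (Smooth E M)) (n : ℕ) :
    (S.mul (const f) g).coeff n = ∑ p ∈ antidiagonal n, S.C p.1 f (g.coeff p.2) := by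
  rw [StarProduct.mul, coeff_ofCoeffs_const, StarProduct.rightCoeff, LinearMap.sum_apply]
  rfl

theorem StarProduct.coeff_const_mul_const (f g : Smooth E M) (n : ℕ) :
    (S.mul (const f) (const g)).coeff n = S.C n f g := by
  rw [S.mul_eq_leftCoeff, coeff_ofCoeffs_const, StarProduct.leftCoeff, LinearMap.sum_apply,
    Finset.sum_eq_single (n, 0)]
  · simp [coeff_const]
  · rintro ⟨i, j⟩ hp hne
    have hj : j ≠ 0 := by
      rintro rfl
      simp at hp
      exact hne (by simp [hp])
    simp [coeff_const, hj]
  · intro h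
    simp at h

theorem StarProduct.mul_assoc (f g k : FormalSeries (Smooth E M)) :
    S.mul (S.mul f g) k = S.mul f (S.mul g k) := by
  -- By linearity in each argument, the series are replaced by constants one argument at a time.
  have h3 : ∀ f g k : Smooth E M, S.mul (S.mul (const f) (const g)) (const k)
      = S.mul (const f) (S.mul (const g) (const k)) := by
    intro f g k
    ext1
    funext n
    simp only [S.coeff_mul_const _ k n, S.coeff_const_mul f _ n, S.coeff_const_mul_const]
    exact S.assoc n f g k
  have h2 : ∀ (f g : Smooth E M) (k : FormalSeries (Smooth E M)),
      S.mul (S.mul (const f) (const g)) k = S.mul (const f) (S.mul (const g) k) := by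
    intro f g k
    have : S.mulLinear (S.mul (const f) (const g))
        = S.mulLinear (const f) ∘ₗ S.mulLinear (const g) := linearMap_ext (h3 f g)
    exact LinearMap.congr_fun this k
  have h1 : ∀ (f : Smooth E M) (g k : FormalSeries (Smooth E M)),
      S.mul (S.mul (const f) g) k = S.mul (const f) (S.mul g k) := by
    intro f g k
    have : S.mulLinear.flip k ∘ₗ S.mulLinear (const f)
        = S.mulLinear (const f) ∘ₗ S.mulLinear.flip k := linearMap_ext fun g => h2 f g k
    exact LinearMap.congr_fun this g
  have : S.mulLinear.flip k ∘ₗ S.mulLinear.flip g = S.mulLinear.flip (S.mul g k) :=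
    linearMap_ext fun f => h1 f g k
  exact LinearMap.congr_fun this f

theorem StarProduct.rightCoeff_zero (g : FormalSeries (Smooth E M)) :
    S.rightCoeff g 0 = LinearMap.mulLeft ℂ (g.coeff 0) := by
  ext1 f
  rw [StarProduct.rightCoeff, Finset.HasAntidiagonal.antidiagonal_zero, Finset.sum_singleton,
    LinearMap.flip_apply, S.C_zero, LinearMap.mulLeft_apply, mul_comm]

end Star

/-! ### Antighosts of low degree -/

section Antighost

variable {𝔤 : Type*} [LieRing 𝔤] [LieAlgebra ℝ 𝔤]
  (A : Type*) [CommRing A] [Algebra ℂ A]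

/-- The map `F ↦ F ⊗ x` from `A` to `⋀ 𝔤 ⊗ A`. -/
noncomputable def tensorAntighost (x : ExteriorAlgebra ℝ 𝔤) : A →ₗ[ℂ] Antighost 𝔤 A :=
  (TensorProduct.AlgebraTensorModule.mk ℝ ℂ A (ExteriorAlgebra ℝ 𝔤)).flip x

/-- The map `F ↦ F ⊗ ξ` from `A` to `𝔤 ⊗ A`. -/
noncomputable def tensorLie (ξ : 𝔤) : A →ₗ[ℂ] A ⊗[ℝ] 𝔤 :=
  (TensorProduct.AlgebraTensorModule.mk ℝ ℂ A 𝔤).flip ξ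

variable {A}

theorem tensorAntighost_apply (x : ExteriorAlgebra ℝ 𝔤) (F : A) :
    tensorAntighost A x F = F ⊗ₜ[ℝ] x := rfl

theorem tensorLie_apply (ξ : 𝔤) (F : A) : tensorLie A ξ F = F ⊗ₜ[ℝ] ξ := rfl

theorem tmap_tmul (D : A →ₗ[ℂ] A) (T : ExteriorAlgebra ℝ 𝔤 →ₗ[ℝ] ExteriorAlgebra ℝ 𝔤) (F : A)
    (x : ExteriorAlgebra ℝ 𝔤) : tmap D T (F ⊗ₜ[ℝ] x) = D F ⊗ₜ[ℝ] T x := rfl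

theorem inc₀_apply (F : A) : inc₀ 𝔤 A F = F ⊗ₜ[ℝ] 1 := rfl

theorem inc₁_tmul (F : A) (ξ : 𝔤) : inc₁ 𝔤 A (F ⊗ₜ[ℝ] ξ) = F ⊗ₜ[ℝ] ExteriorAlgebra.ι ℝ ξ := rfl

theorem pr₀_tmul_algebraMap (F : A) (r : ℝ) :
    pr₀ 𝔤 A (F ⊗ₜ[ℝ] algebraMap ℝ (ExteriorAlgebra ℝ 𝔤) r) = r • F := by
  have h : pr₀ 𝔤 A (F ⊗ₜ[ℝ] algebraMap ℝ (ExteriorAlgebra ℝ 𝔤) r)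
      = (ExteriorAlgebra.algebraMapInv (algebraMap ℝ (ExteriorAlgebra ℝ 𝔤) r) : ℝ) • F := rfl
  rw [h, ExteriorAlgebra.algebraMap_leftInverse]

theorem pr₀_inc₀ (F : A) : pr₀ 𝔤 A (inc₀ 𝔤 A F) = F := by
  rw [inc₀_apply, ← map_one (algebraMap ℝ (ExteriorAlgebra ℝ 𝔤)), pr₀_tmul_algebraMap, one_smul]

theorem pr₁_tmul_ι (F : A) (ξ : 𝔤) :
    pr₁ 𝔤 A (F ⊗ₜ[ℝ] ExteriorAlgebra.ι ℝ ξ) = F ⊗ₜ[ℝ] ξ := by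
  have h : pr₁ 𝔤 A (F ⊗ₜ[ℝ] ExteriorAlgebra.ι ℝ ξ)
      = F ⊗ₜ[ℝ] ExteriorAlgebra.ιInv (ExteriorAlgebra.ι ℝ ξ) := rfl
  rw [h, ExteriorAlgebra.ι_leftInverse]

theorem pr₁_inc₁ (w : A ⊗[ℝ] 𝔤) : pr₁ 𝔤 A (inc₁ 𝔤 A w) = w := by
  induction w using TensorProduct.induction_on with
  | zero => simp
  | tmul F ξ => rw [inc₁_tmul, pr₁_tmul_ι]
  | add x y hx hy => rw [map_add, map_add, hx, hy]

theorem inc₀_mem (F : A) : inc₀ 𝔤 A F ∈ antighostPart 𝔤 A 0 :=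
  Submodule.subset_span ⟨1, by simp, F, rfl⟩

theorem inc₁_mem (w : A ⊗[ℝ] 𝔤) : inc₁ 𝔤 A w ∈ antighostPart 𝔤 A 1 := by
  induction w using TensorProduct.induction_on with
  | zero => simp
  | tmul F ξ => exact Submodule.subset_span ⟨ExteriorAlgebra.ι ℝ ξ, by simp, F, inc₁_tmul F ξ⟩
  | add x y hx hy => rw [map_add]; exact add_mem hx hy

theorem inc₁_pr₁ {w : Antighost 𝔤 A} (hw : w ∈ antighostPart 𝔤 A 1) :
    inc₁ 𝔤 A (pr₁ 𝔤 A w) = w := by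
  induction hw using Submodule.span_induction with
  | mem w hw =>
    obtain ⟨x, hx, F, rfl⟩ := hw
    rw [ExteriorAlgebra.exteriorPower, pow_one] at hx
    obtain ⟨ξ, rfl⟩ := hx
    rw [pr₁_tmul_ι, inc₁_tmul]
  | zero => simp
  | add x y _ _ hx hy => rw [map_add, map_add, hx, hy]
  | smul c x _ hx => rw [map_smul, map_smul, hx]

/-- Antighost degree two is spanned by the products `F ⊗ ξ ∧ η`. -/
theorem antighostPart_two_le (P : Submodule ℂ (Antighost 𝔤 A))
    (h : ∀ (F : A) (ξ η : 𝔤), F ⊗ₜ[ℝ] (ExteriorAlgebra.ι ℝ ξ * ExteriorAlgebra.ι ℝ η) ∈ P) :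
    antighostPart 𝔤 A 2 ≤ P := by
  refine Submodule.span_le.2 ?_
  rintro _ ⟨x, hx, F, rfl⟩
  rw [ExteriorAlgebra.exteriorPower, pow_two] at hx
  induction hx using Submodule.mul_induction_on' with
  | mem_mul_mem y hy z hz =>
    obtain ⟨ξ, rfl⟩ := hy
    obtain ⟨η, rfl⟩ := hz
    exact h F ξ η
  | add y _ z _ hy hz => rw [TensorProduct.tmul_add]; exact add_mem hy hz

theorem insertion_ι (β : Module.Dual ℝ 𝔤) (ξ : 𝔤) :
    insertion β (ExteriorAlgebra.ι ℝ ξ) = algebraMap ℝ (ExteriorAlgebra ℝ 𝔤) (β ξ) :=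
  CliffordAlgebra.contractLeft_ι _ _ _

theorem insertion_ι_mul_ι (β : Module.Dual ℝ 𝔤) (ξ η : 𝔤) :
    insertion β (ExteriorAlgebra.ι ℝ ξ * ExteriorAlgebra.ι ℝ η)
      = ExteriorAlgebra.ι ℝ (β ξ • η - β η • ξ) := by
  have h : insertion β (ExteriorAlgebra.ι ℝ ξ * ExteriorAlgebra.ι ℝ η)
      = β ξ • ExteriorAlgebra.ι ℝ η
        - ExteriorAlgebra.ι ℝ ξ * insertion β (ExteriorAlgebra.ι ℝ η) :=
    CliffordAlgebra.contractLeft_ι_mul _ _ _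
  rw [h, insertion_ι, map_sub, map_smul, map_smul, ← Algebra.commutes, Algebra.smul_def (β η)]

theorem insertion_algebraMap (β : Module.Dual ℝ 𝔤) (r : ℝ) :
    insertion β (algebraMap ℝ (ExteriorAlgebra ℝ 𝔤) r) = 0 :=
  CliffordAlgebra.contractLeft_algebraMap _ _ _

theorem traceAd_lie (ξ η : 𝔤) : traceAd 𝔤 ⁅ξ, η⁆ = 0 := by
  let ad : 𝔤 →ₗ[ℝ] 𝔤 →ₗ[ℝ] 𝔤 :=
    LinearMap.mk₂ ℝ (fun ξ η : 𝔤 => ⁅ξ, η⁆) add_lie smul_lie lie_add lie_smul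
  have had : ad ⁅ξ, η⁆ = ad ξ ∘ₗ ad η - ad η ∘ₗ ad ξ := LinearMap.ext fun ζ => lie_lie ξ η ζ
  have h : traceAd 𝔤 ⁅ξ, η⁆ = LinearMap.trace ℝ 𝔤 (ad ⁅ξ, η⁆) := rfl
  rw [h, had, map_sub]
  exact sub_eq_zero.2 (LinearMap.trace_mul_comm ℝ (ad ξ) (ad η))

variable (A) [FiniteDimensional ℝ 𝔤]

theorem opQ_tmul_ι (F : A) (ξ : 𝔤) : opQ 𝔤 A (F ⊗ₜ[ℝ] ExteriorAlgebra.ι ℝ ξ) = 0 := by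
  rw [opQ, tmap_tmul]
  simp [insertion_ι, insertion_algebraMap]

theorem opQ_tmul_ι_mul_ι (F : A) (ξ η : 𝔤) :
    opQ 𝔤 A (F ⊗ₜ[ℝ] (ExteriorAlgebra.ι ℝ ξ * ExteriorAlgebra.ι ℝ η))
      = F ⊗ₜ[ℝ] ExteriorAlgebra.ι ℝ ⁅ξ, η⁆ := by
  rw [opQ, tmap_tmul, LinearMap.id_apply]
  congr 1
  have hlie : ∀ x y : 𝔤, ∑ a, ∑ b, ((Module.finBasis ℝ 𝔤).coord a x *
      (Module.finBasis ℝ 𝔤).coord b y) • ⁅Module.finBasis ℝ 𝔤 a, Module.finBasis ℝ 𝔤 b⁆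
      = ⁅x, y⁆ := by
    intro x y
    conv_rhs => rw [← (Module.finBasis ℝ 𝔤).sum_repr x, ← (Module.finBasis ℝ 𝔤).sum_repr y]
    rw [sum_lie]
    refine Finset.sum_congr rfl fun a _ => ?_
    rw [lie_sum]
    refine Finset.sum_congr rfl fun b _ => ?_
    rw [smul_lie, lie_smul, smul_smul, Module.Basis.coord_apply, Module.Basis.coord_apply]
  have key : ∀ a b, (LinearMap.mulLeft ℝ
        (ExteriorAlgebra.ι ℝ ⁅Module.finBasis ℝ 𝔤 a, Module.finBasis ℝ 𝔤 b⁆) ∘ₗ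
      insertion ((Module.finBasis ℝ 𝔤).coord a) ∘ₗ insertion ((Module.finBasis ℝ 𝔤).coord b))
        (ExteriorAlgebra.ι ℝ ξ * ExteriorAlgebra.ι ℝ η)
      = ExteriorAlgebra.ι ℝ
        (((Module.finBasis ℝ 𝔤).coord a η * (Module.finBasis ℝ 𝔤).coord b ξ) •
            ⁅Module.finBasis ℝ 𝔤 a, Module.finBasis ℝ 𝔤 b⁆
          - ((Module.finBasis ℝ 𝔤).coord a ξ * (Module.finBasis ℝ 𝔤).coord b η) •
            ⁅Module.finBasis ℝ 𝔤 a, Module.finBasis ℝ 𝔤 b⁆) := by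
    intro a b
    rw [LinearMap.comp_apply, LinearMap.comp_apply, insertion_ι_mul_ι, insertion_ι,
      LinearMap.mulLeft_apply, ← Algebra.commutes, ← Algebra.smul_def, ← map_smul, ← sub_smul]
    congr 2
    simp only [map_sub, map_smul, smul_eq_mul]
    ring
  rw [LinearMap.smul_apply]
  simp only [LinearMap.sum_apply, key]
  simp only [← map_sum, Finset.sum_sub_distrib, hlie, ← map_smul]
  rw [← lie_skew η ξ]
  congr 1
  module

end Antighost

/-! ### The quantised Koszul operator in low degrees -/

section Koszul

open FormalSeries

/-- The linear algebra behind `∂̂_1 ∂̂_2 (f ⊗ ξ ∧ η) = 0`, with `l = iλ`, `h = 1 / 2`, `s` and `t`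
the values of `tr ∘ ad` at `ξ` and `η`, and `x`, `y`, `z`, `u` standing for `f * J_ξ`, `f * J_η`,
`f * J_[ξ,η]` and `f * J_η * J_ξ`. -/
theorem qKoszul_square_cancellation {R N : Type*} [CommRing R] [AddCommGroup N] [Module R N] (l h s t : R)
    (x y z u f : N) :
    l • z + u + l • h • t • x - (u + l • h • s • y)
      + l • (h • (s • (y + l • h • t • f) - t • (x + l • h • s • f))
        - (z + l • h • (0 : R) • f)) = 0 := by
  module

variable {E : Type*} [NormedAddCommGroup E] [NormedSpace ℝ E] [FiniteDimensional ℝ E]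
  {M : Type*} [TopologicalSpace M] [ChartedSpace E M]
  {Ω : SymplecticForm E M} {S : StarProduct Ω}
  {𝔤 : Type*} [LieRing 𝔤] [LieAlgebra ℝ 𝔤] (Q : QuantumMomentumMap S 𝔤)

/-- Right star multiplication by `⟨J, ξ⟩`. -/
noncomputable def mulComp (ξ : 𝔤) :
    FormalSeries (Smooth E M) →ₗ[PowerSeries ℂ] FormalSeries (Smooth E M) :=
  S.mulLinear.flip (Q.comp ξ)

/-- Associativity turns the commutation relation of the quantum momentum map into one between
right multiplications, in the opposite order. -/
theorem mulComp_commutator (ξ η : 𝔤) (f : FormalSeries (Smooth E M)) :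
    mulComp Q η (mulComp Q ξ f) - mulComp Q ξ (mulComp Q η f)
      = (PowerSeries.C Complex.I * PowerSeries.X : PowerSeries ℂ) • mulComp Q ⁅ξ, η⁆ f := by
  simp only [mulComp, LinearMap.flip_apply]
  simp only [S.mulLinear_apply f, S.mulLinear_apply (S.mul f _), S.mul_assoc]
  simp only [← S.mulLinear_apply f, ← map_sub, ← map_smul]
  exact congrArg _ (Q.covariant ξ η)

variable [FiniteDimensional ℝ 𝔤]

theorem opCoeff_zero_qKoszul : opCoeff (qKoszul Q) 0 = koszul Q := by
  refine LinearMap.ext fun w => ?_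
  rw [opCoeff_apply, qKoszul, LinearMap.add_apply, LinearMap.smul_apply, mul_smul, coeff_add,
    coeff_C_smul, coeff_X_smul_zero, smul_zero, add_zero, rightMul, coeff_ofCoeffs_const, koszul]
  simp only [StarProduct.rightCoeff_zero]

theorem opCoeff_zero_qKoszul₁ : opCoeff (qKoszul₁ Q) 0 = koszul₁ Q := by
  rw [qKoszul₁, opCoeff_zero_comp, opCoeff_zero_comp, opCoeff_zero_qKoszul, opCoeff_map_zero,
    opCoeff_map_zero, koszul₁]

theorem koszul_inc₁ (w : Smooth E M ⊗[ℝ] 𝔤) :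
    koszul Q (inc₁ 𝔤 _ w) = inc₀ 𝔤 _ (koszul₁ Q w) := by
  suffices h : ∃ F, koszul Q (inc₁ 𝔤 _ w) = inc₀ 𝔤 _ F by
    obtain ⟨F, hF⟩ := h
    rw [koszul₁, LinearMap.comp_apply, LinearMap.comp_apply, hF, pr₀_inc₀]
  induction w using TensorProduct.induction_on with
  | zero => exact ⟨0, by simp⟩
  | tmul F ξ =>
    refine ⟨∑ a, (Module.finBasis ℝ 𝔤).coord a ξ •
      (LinearMap.mulLeft ℂ ((Q.comp (Module.finBasis ℝ 𝔤 a)).coeff 0) F), ?_⟩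
    rw [inc₁_tmul, koszul, LinearMap.sum_apply, map_sum]
    refine Finset.sum_congr rfl fun a _ => ?_
    rw [tmap_tmul, insertion_ι, inc₀_apply, Algebra.algebraMap_eq_smul_one,
      TensorProduct.tmul_smul, TensorProduct.smul_tmul']
  | add x y hx hy =>
    obtain ⟨F, hF⟩ := hx
    obtain ⟨G, hG⟩ := hy
    exact ⟨F + G, by simp only [map_add, hF, hG]⟩

theorem comp_eq_sum (ξ : 𝔤) : Q.comp ξ = ∑ a,
    PowerSeries.C (((Module.finBasis ℝ 𝔤).coord a ξ : ℝ) : ℂ) •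
      Q.comp (Module.finBasis ℝ 𝔤 a) := by
  ext1
  funext n
  rw [coeff_sum]
  simp only [coeff_C_smul]
  ext x
  have h : Q.J n x ξ = ∑ a, (Module.finBasis ℝ 𝔤).coord a ξ * Q.J n x (Module.finBasis ℝ 𝔤 a) := by
    conv_lhs => rw [← (Module.finBasis ℝ 𝔤).sum_repr ξ]
    simp only [map_sum, map_smul, smul_eq_mul, Module.Basis.coord_apply]
  have h' : (((Q.comp ξ).coeff n).1 x : ℂ) = ((Q.J n x ξ : ℝ) : ℂ) := rfl
  rw [h', h]
  push_cast
  rw [Finset.sum_apply]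
  rfl

theorem mulComp_eq_sum (ξ : 𝔤) (f : FormalSeries (Smooth E M)) : mulComp Q ξ f = ∑ a,
    PowerSeries.C (((Module.finBasis ℝ 𝔤).coord a ξ : ℝ) : ℂ) •
      mulComp Q (Module.finBasis ℝ 𝔤 a) f := by
  simp only [mulComp, LinearMap.flip_apply]
  rw [comp_eq_sum, map_sum]
  simp only [map_smul]

theorem rightMul_map_tensorAntighost (x : ExteriorAlgebra ℝ 𝔤) (f : FormalSeries (Smooth E M)) :
    rightMul Q (map (tensorAntighost _ x) f) = ∑ a,
      map (tensorAntighost _ (insertion ((Module.finBasis ℝ 𝔤).coord a) x))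
        (mulComp Q (Module.finBasis ℝ 𝔤 a) f) := by
  suffices h : rightMul Q ∘ₗ map (tensorAntighost _ x) = ∑ a,
      map (tensorAntighost _ (insertion ((Module.finBasis ℝ 𝔤).coord a) x)) ∘ₗ
        mulComp Q (Module.finBasis ℝ 𝔤 a) by
    simpa [LinearMap.sum_apply] using LinearMap.congr_fun h f
  refine linearMap_ext fun F => ?_
  ext1
  funext n
  rw [LinearMap.comp_apply, FormalSeries.map_const, rightMul, coeff_ofCoeffs_const,
    LinearMap.sum_apply, LinearMap.sum_apply, coeff_sum]
  refine Finset.sum_congr rfl fun a _ => ?_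
  rw [tensorAntighost_apply, tmap_tmul, LinearMap.comp_apply, coeff_map, tensorAntighost_apply]
  congr 1
  exact (coeff_ofCoeffs_const _ _ _).symm

theorem qKoszul_map_tensorAntighost (x : ExteriorAlgebra ℝ 𝔤) (f : FormalSeries (Smooth E M)) :
    qKoszul Q (map (tensorAntighost _ x) f) = ∑ a,
      map (tensorAntighost _ (insertion ((Module.finBasis ℝ 𝔤).coord a) x))
        (mulComp Q (Module.finBasis ℝ 𝔤 a) f)
      + (PowerSeries.C Complex.I * PowerSeries.X : PowerSeries ℂ) •
        (PowerSeries.C (1 / 2 : ℂ) • map (tensorAntighost _ (insertion (traceAd 𝔤) x)) f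
          - map (opQ 𝔤 (Smooth E M) ∘ₗ tensorAntighost _ x) f) := by
  rw [qKoszul, LinearMap.add_apply, rightMul_map_tensorAntighost, LinearMap.smul_apply,
    map_sub_left, map_smul_left, map_map, map_map]
  rfl

/-- The value of `∂̂_1` on `f ⊗ ξ`. -/
theorem qKoszul₁_map_tensorLie (ξ : 𝔤) (f : FormalSeries (Smooth E M)) :
    qKoszul₁ Q (map (tensorLie _ ξ) f) = mulComp Q ξ f
      + (PowerSeries.C Complex.I * PowerSeries.X : PowerSeries ℂ) •
        (PowerSeries.C (1 / 2 : ℂ) • PowerSeries.C ((traceAd 𝔤 ξ : ℝ) : ℂ) • f) := by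
  have h0 : ∀ (r : ℝ) (g : FormalSeries (Smooth E M)), map (pr₀ 𝔤 (Smooth E M))
      (map (tensorAntighost _ (algebraMap ℝ (ExteriorAlgebra ℝ 𝔤) r)) g)
        = PowerSeries.C (r : ℂ) • g := by
    intro r g
    ext1
    funext n
    rw [coeff_map, coeff_map, tensorAntighost_apply, pr₀_tmul_algebraMap, coeff_C_smul]
    rfl
  have hQ : opQ 𝔤 (Smooth E M) ∘ₗ tensorAntighost _ (ExteriorAlgebra.ι ℝ ξ) = 0 :=
    LinearMap.ext fun F => opQ_tmul_ι _ F ξ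
  have h1 : map (inc₁ 𝔤 (Smooth E M)) (map (tensorLie _ ξ) f)
      = map (tensorAntighost _ (ExteriorAlgebra.ι ℝ ξ)) f := map_map _ _ _
  rw [qKoszul₁, LinearMap.comp_apply, LinearMap.comp_apply, h1, qKoszul_map_tensorAntighost, hQ,
    map_zero_left, sub_zero, map_add, map_smul, map_smul, map_sum, mulComp_eq_sum]
  simp only [insertion_ι, h0]

/-- The value of `∂̂_2` on `f ⊗ ξ ∧ η`. -/
theorem map_pr₁_qKoszul (ξ η : 𝔤) (f : FormalSeries (Smooth E M)) :
    map (pr₁ 𝔤 (Smooth E M)) (qKoszul Q (map (tensorAntighost _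
        (ExteriorAlgebra.ι ℝ ξ * ExteriorAlgebra.ι ℝ η)) f))
      = map (tensorLie _ η) (mulComp Q ξ f) - map (tensorLie _ ξ) (mulComp Q η f)
        + (PowerSeries.C Complex.I * PowerSeries.X : PowerSeries ℂ) •
        (PowerSeries.C (1 / 2 : ℂ) •
            (PowerSeries.C ((traceAd 𝔤 ξ : ℝ) : ℂ) • map (tensorLie _ η) f
              - PowerSeries.C ((traceAd 𝔤 η : ℝ) : ℂ) • map (tensorLie _ ξ) f)
          - map (tensorLie _ ⁅ξ, η⁆) f) := by
  have h1 : ∀ (β : Module.Dual ℝ 𝔤) (g : FormalSeries (Smooth E M)),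
      map (pr₁ 𝔤 (Smooth E M)) (map (tensorAntighost _
        (insertion β (ExteriorAlgebra.ι ℝ ξ * ExteriorAlgebra.ι ℝ η))) g)
      = PowerSeries.C ((β ξ : ℝ) : ℂ) • map (tensorLie _ η) g
        - PowerSeries.C ((β η : ℝ) : ℂ) • map (tensorLie _ ξ) g := by
    intro β g
    ext1
    funext n
    rw [coeff_map, coeff_map, tensorAntighost_apply, insertion_ι_mul_ι, pr₁_tmul_ι, coeff_sub,
      coeff_C_smul, coeff_C_smul, coeff_map, coeff_map, tensorLie_apply, tensorLie_apply,
      TensorProduct.tmul_sub, TensorProduct.tmul_smul, TensorProduct.tmul_smul]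
    rfl
  have hQ : pr₁ 𝔤 (Smooth E M) ∘ₗ opQ 𝔤 (Smooth E M) ∘ₗ tensorAntighost _
      (ExteriorAlgebra.ι ℝ ξ * ExteriorAlgebra.ι ℝ η) = tensorLie _ ⁅ξ, η⁆ :=
    LinearMap.ext fun F => by
      rw [LinearMap.comp_apply, LinearMap.comp_apply, tensorAntighost_apply, opQ_tmul_ι_mul_ι,
        pr₁_tmul_ι, tensorLie_apply]
  rw [qKoszul_map_tensorAntighost, map_add, map_sum, map_smul, map_sub, map_smul,
    map_map _ (opQ _ _ ∘ₗ _), hQ, mulComp_eq_sum Q ξ, mulComp_eq_sum Q η]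
  simp only [h1, Finset.sum_sub_distrib, map_sum, map_smul]

/-- `∂̂_1 ∂̂_2 = 0`: the commutator of the right multiplications by `⟨J, ξ⟩` and `⟨J, η⟩` cancels
against `q`, and `tr (ad [ξ, η]) = 0` takes care of the correction by `u`. -/
theorem qKoszul₁_qKoszul {w : Antighost 𝔤 (Smooth E M)}
    (hw : w ∈ antighostPart 𝔤 (Smooth E M) 2) :
    qKoszul₁ Q (map (pr₁ 𝔤 (Smooth E M)) (qKoszul Q (const w))) = 0 := by
  let T := qKoszul₁ Q ∘ₗ map (pr₁ 𝔤 (Smooth E M)) ∘ₗ qKoszul Q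
  suffices h : antighostPart 𝔤 (Smooth E M) 2 ≤ ⨅ n, LinearMap.ker (opCoeff T n) by
    ext1
    funext n
    exact (Submodule.mem_iInf _).1 (h hw) n
  refine antighostPart_two_le _ fun F ξ η => (Submodule.mem_iInf _).2 fun n => ?_
  rw [LinearMap.mem_ker, opCoeff_apply]
  have hc : const (F ⊗ₜ[ℝ] (ExteriorAlgebra.ι ℝ ξ * ExteriorAlgebra.ι ℝ η))
      = map (tensorAntighost _ (ExteriorAlgebra.ι ℝ ξ * ExteriorAlgebra.ι ℝ η)) (const F) := by
    rw [FormalSeries.map_const, tensorAntighost_apply]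
  have hT : T (const (F ⊗ₜ[ℝ] (ExteriorAlgebra.ι ℝ ξ * ExteriorAlgebra.ι ℝ η))) = 0 := by
    have hcomm := mulComp_commutator Q ξ η (const F)
    simp only [T, LinearMap.comp_apply, hc, map_pr₁_qKoszul, map_add, map_sub, map_smul,
      qKoszul₁_map_tensorLie, traceAd_lie]
    rw [sub_eq_iff_eq_add] at hcomm
    rw [hcomm]
    rw [Complex.ofReal_zero, map_zero]
    exact qKoszul_square_cancellation _ _ _ _ _ _ _ _ _
  rw [hT, coeff_zero]

end Koszul

/-! ### Homological perturbation of the restriction -/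

section Perturbation

open FormalSeries

variable {E : Type*} [NormedAddCommGroup E] [NormedSpace ℝ E] [FiniteDimensional ℝ E]
  {M : Type*} [TopologicalSpace M] [ChartedSpace E M]
  {Ω : SymplecticForm E M} {S : StarProduct Ω}
  {𝔤 : Type*} [LieRing 𝔤] [LieAlgebra ℝ 𝔤] [FiniteDimensional ℝ 𝔤]
  {Q : QuantumMomentumMap S 𝔤}
  {F : Type*} [NormedAddCommGroup F] [NormedSpace ℝ F]
  {C : Type*} [TopologicalSpace C] [ChartedSpace F C]

theorem X_smul_opB₁ (Q : QuantumMomentumMap S 𝔤) :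
    (PowerSeries.X : PowerSeries ℂ) • opB₁ Q
      = ghostMap 𝔤 (koszul₁ Q) - ghostExtSeries 𝔤 (qKoszul₁ Q) := by
  refine X_smul_divLambda ?_
  have h : opCoeff (ghostMap 𝔤 (koszul₁ Q)) 0 = opCoeff (ghostExtSeries 𝔤 (qKoszul₁ Q)) 0 := by
    rw [opCoeff_zero_ghostExtSeries, opCoeff_zero_qKoszul₁, ghostMap, opCoeff_map_zero]
  refine LinearMap.ext fun w => ?_
  rw [opCoeff_apply, LinearMap.sub_apply, coeff_sub, ← opCoeff_apply, ← opCoeff_apply, h, sub_self,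
    LinearMap.zero_apply]

theorem isUnit_perturbation (Q : QuantumMomentumMap S 𝔤)
    (h : Antighost 𝔤 (Smooth E M) →ₗ[ℂ] Antighost 𝔤 (Smooth E M)) :
    IsUnit (perturbation Q h) :=
  isUnit_one_sub_X_smul _

theorem opCoeff_zero_perturbation (Q : QuantumMomentumMap S 𝔤)
    (h : Antighost 𝔤 (Smooth E M) →ₗ[ℂ] Antighost 𝔤 (Smooth E M)) :
    opCoeff (perturbation Q h) 0 = LinearMap.id := by
  refine LinearMap.ext fun w => ?_
  rw [opCoeff_apply, perturbation, LinearMap.sub_apply, coeff_sub, LinearMap.smul_apply,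
    coeff_X_smul_zero, sub_zero]
  rfl

/-- The equation which characterises the deformed restriction. -/
theorem qRestriction_comp_perturbation (res : Smooth E M →ₗ[ℂ] Smooth F C)
    (h : Antighost 𝔤 (Smooth E M) →ₗ[ℂ] Antighost 𝔤 (Smooth E M)) :
    qRestriction Q res h ∘ₗ perturbation Q h = ghostMap 𝔤 res := by
  rw [qRestriction, LinearMap.comp_assoc, ← Module.End.mul_eq_comp,
    Ring.inverse_mul_cancel _ (isUnit_perturbation Q h), Module.End.one_eq_id, LinearMap.comp_id]

theorem eq_qRestriction {res : Smooth E M →ₗ[ℂ] Smooth F C}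
    {h : Antighost 𝔤 (Smooth E M) →ₗ[ℂ] Antighost 𝔤 (Smooth E M)}
    {R : FormalSeries (Ghost 𝔤 (Smooth E M)) →ₗ[PowerSeries ℂ] FormalSeries (Ghost 𝔤 (Smooth F C))}
    (hR : R ∘ₗ perturbation Q h = ghostMap 𝔤 res) : R = qRestriction Q res h := by
  rw [qRestriction, ← hR, LinearMap.comp_assoc, ← Module.End.mul_eq_comp,
    Ring.mul_inverse_cancel _ (isUnit_perturbation Q h), Module.End.one_eq_id, LinearMap.comp_id]

theorem opCoeff_zero_qRestriction (res : Smooth E M →ₗ[ℂ] Smooth F C)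
    (h : Antighost 𝔤 (Smooth E M) →ₗ[ℂ] Antighost 𝔤 (Smooth E M)) :
    opCoeff (qRestriction Q res h) 0 = ghostExt 𝔤 res := by
  have := opCoeff_zero_comp (qRestriction Q res h) (perturbation Q h)
  rwa [qRestriction_comp_perturbation, opCoeff_zero_perturbation, LinearMap.comp_id, ghostMap,
    opCoeff_map_zero, eq_comm] at this

/-- The Koszul operator takes values in the classical vanishing ideal of the constraint surface. -/
theorem pullback_comp_koszul₁ {ι : C → M} (hC : Q.IsRegularConstraintSurface (F := F) ι) :
    pullback ι hC.embedding.contMDiff ∘ₗ koszul₁ Q = 0 := by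
  have hJ : ∀ (ξ : 𝔤) (f : Smooth E M),
      pullback ι hC.embedding.contMDiff (f * (Q.comp ξ).coeff 0) = 0 := by
    intro ξ f
    refine Subtype.ext (funext fun c => ?_)
    have h0 : Q.J 0 (ι c) = 0 := by
      have : ι c ∈ {x | Q.J 0 x = 0} := hC.range_eq ▸ Set.mem_range_self c
      exact this
    change f.1 (ι c) * ((Q.J 0 (ι c) ξ : ℝ) : ℂ) = 0
    rw [h0, LinearMap.zero_apply, Complex.ofReal_zero, mul_zero]
  refine LinearMap.ext fun w => ?_
  rw [LinearMap.comp_apply, LinearMap.zero_apply]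
  induction w using TensorProduct.induction_on with
  | zero => simp
  | tmul f ξ =>
    -- `∂_1` is the lowest order of `∂̂_1`, and `C_0` is the pointwise product.
    have h1 := congrArg (fun g => g.coeff 0) (qKoszul₁_map_tensorLie Q ξ (const f))
    simp only [FormalSeries.map_const, coeff_add, mul_smul, coeff_C_smul, coeff_X_smul_zero,
      smul_zero, add_zero] at h1
    rw [← opCoeff_apply, opCoeff_zero_qKoszul₁, tensorLie_apply, mulComp, LinearMap.flip_apply,
      S.mulLinear_apply, S.coeff_const_mul, Finset.HasAntidiagonal.antidiagonal_zero,
      Finset.sum_singleton, S.C_zero] at h1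
    rw [h1, hJ]
  | add x y hx hy => rw [map_add, map_add, hx, hy, add_zero]

variable {res : Smooth E M →ₗ[ℂ] Smooth F C} {prol : Smooth F C →ₗ[ℂ] Smooth E M}
  {h : Antighost 𝔤 (Smooth E M) →ₗ[ℂ] Antighost 𝔤 (Smooth E M)}

namespace IsKoszulHomotopy

variable (hh : IsKoszulHomotopy Q res prol h)
include hh

theorem inc₁_homotopy₀ (f : Smooth E M) :
    inc₁ 𝔤 _ (homotopy₀ h f) = h (inc₀ 𝔤 _ f) :=
  inc₁_pr₁ (hh.degree 0 _ (inc₀_mem f))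

theorem prol_res_add (f : Smooth E M) :
    prol (res f) + koszul₁ Q (homotopy₀ h f) = f := by
  have h1 := congrArg (pr₀ 𝔤 (Smooth E M)) (hh.homotopy_zero f)
  rwa [← hh.inc₁_homotopy₀, koszul_inc₁, map_add, pr₀_inc₀, pr₀_inc₀, pr₀_inc₀] at h1

theorem homotopy₀_prol (φ : Smooth F C) : homotopy₀ h (prol φ) = 0 := by
  rw [homotopy₀, LinearMap.comp_apply, LinearMap.comp_apply, hh.h_prol, map_zero]

theorem homotopy₀_koszul₁_add (w : Smooth E M ⊗[ℝ] 𝔤) :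
    homotopy₀ h (koszul₁ Q w) + pr₁ 𝔤 _ (koszul Q (h (inc₁ 𝔤 _ w))) = w := by
  have h1 := congrArg (pr₁ 𝔤 (Smooth E M)) (hh.homotopy_pos 0 _ (inc₁_mem w))
  rwa [map_add, pr₁_inc₁, koszul_inc₁] at h1

theorem perturbation_eq : perturbation Q h = ghostMap 𝔤 prol ∘ₗ ghostMap 𝔤 res
    + ghostExtSeries 𝔤 (qKoszul₁ Q) ∘ₗ ghostMap 𝔤 (homotopy₀ h) := by
  have h1 : ghostMap 𝔤 prol ∘ₗ ghostMap 𝔤 res + ghostMap 𝔤 (koszul₁ Q) ∘ₗ ghostMap 𝔤 (homotopy₀ h)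
      = 1 := by
    refine ghostSeries_ext fun α f => ?_
    simp only [LinearMap.add_apply, LinearMap.comp_apply, ghostMap_map_tensorGhost, parity_parity,
      Module.End.one_apply]
    rw [← map_add, map_map, map_map, ← map_add_left]
    congr 1
    convert map_id f using 3
    exact LinearMap.ext fun g => hh.prol_res_add g
  rw [perturbation, ← LinearMap.smul_comp, X_smul_opB₁, LinearMap.sub_comp, ← h1]
  abel

/-- Evaluated on `α ⊗ f`, the operator `id - λ B₁ h₀` is `prol ι^* + ∂̂_1 h₀` on the second
factor, the signs cancelling in pairs. -/
theorem perturbation_map_tensorGhost (α : ExteriorAlgebra ℝ (Module.Dual ℝ 𝔤))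
    (f : FormalSeries (Smooth E M)) :
    perturbation Q h (map (tensorGhost 𝔤 _ α) f) = map (tensorGhost 𝔤 _ α)
      (map prol (map res f) + qKoszul₁ Q (map (homotopy₀ h) f)) := by
  rw [hh.perturbation_eq, map_add]
  simp only [LinearMap.add_apply, LinearMap.comp_apply, ghostMap_map_tensorGhost,
    ghostExtSeries_map_tensorGhost, parity_parity]

theorem qRestriction_comp_prol :
    qRestriction Q res h ∘ₗ ghostMap 𝔤 prol = LinearMap.id := by
  have h1 : perturbation Q h ∘ₗ ghostMap 𝔤 prol = ghostMap 𝔤 prol := by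
    refine ghostSeries_ext fun α f => ?_
    rw [LinearMap.comp_apply, ghostMap_map_tensorGhost, hh.perturbation_map_tensorGhost,
      map_map res, hh.res_prol, map_id, map_map (homotopy₀ h)]
    have h0 : homotopy₀ h ∘ₗ prol = 0 := LinearMap.ext hh.homotopy₀_prol
    rw [h0, map_zero_left, map_zero, add_zero]
  have h2 : ghostMap 𝔤 res ∘ₗ ghostMap 𝔤 prol = LinearMap.id := by
    refine ghostSeries_ext fun α f => ?_
    rw [LinearMap.comp_apply, ghostMap_map_tensorGhost, ghostMap_map_tensorGhost, parity_parity,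
      map_map res, hh.res_prol, map_id, LinearMap.id_apply]
  rw [← h1, ← LinearMap.comp_assoc, qRestriction_comp_perturbation, h2]

/-- Since `id = h₀ ∂_1 + ∂_2 h_1` and `∂̂_2` deforms `∂_2`, the operator `h₀ ∂_1 + ∂̂_2 h_1` is
invertible; as `∂̂_1 ∂̂_2 = 0`, every element of the quantum vanishing ideal is of the form
`∂̂_1 h₀ ∂_1 f`. -/
theorem exists_qKoszul₁_eq (f : FormalSeries (Smooth E M ⊗[ℝ] 𝔤)) :
    ∃ g, qKoszul₁ Q f = qKoszul₁ Q (map (homotopy₀ h) (map (koszul₁ Q) g)) := by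
  let D₂ : FormalSeries (Smooth E M ⊗[ℝ] 𝔤) →ₗ[PowerSeries ℂ] FormalSeries (Smooth E M ⊗[ℝ] 𝔤) :=
    map (pr₁ 𝔤 _) ∘ₗ qKoszul Q ∘ₗ map (h ∘ₗ inc₁ 𝔤 _)
  let U : Module.End (PowerSeries ℂ) (FormalSeries (Smooth E M ⊗[ℝ] 𝔤)) :=
    map (homotopy₀ h) ∘ₗ map (koszul₁ Q) + D₂
  have hD : qKoszul₁ Q ∘ₗ D₂ = 0 := by
    refine linearMap_ext fun w => ?_
    rw [LinearMap.comp_apply, LinearMap.comp_apply, LinearMap.comp_apply, FormalSeries.map_const]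
    exact qKoszul₁_qKoszul Q (hh.degree 1 _ (inc₁_mem w))
  have hU : opCoeff U 0 = LinearMap.id := by
    refine LinearMap.ext fun w => ?_
    rw [opCoeff_apply, LinearMap.add_apply, coeff_add, ← opCoeff_apply, ← opCoeff_apply,
      opCoeff_zero_comp, opCoeff_zero_comp, opCoeff_zero_comp, opCoeff_zero_qKoszul]
    simp only [opCoeff_map_zero]
    exact hh.homotopy₀_koszul₁_add w
  obtain ⟨g, hg⟩ := ((Module.End.isUnit_iff _).1 (isUnit_of_opCoeff_zero hU)).2 f
  refine ⟨g, ?_⟩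
  rw [← hg, LinearMap.add_apply, map_add, ← LinearMap.comp_apply (qKoszul₁ Q) D₂, hD]
  simp

theorem qRestriction_comp_qKoszul₁ (hres : res ∘ₗ koszul₁ Q = 0) :
    qRestriction Q res h ∘ₗ ghostExtSeries 𝔤 (qKoszul₁ Q) = 0 := by
  refine ghostSeries_ext fun α f => ?_
  obtain ⟨g, hg⟩ := hh.exists_qKoszul₁_eq f
  have h0 : map res (map (koszul₁ Q) g) = 0 := by rw [map_map, hres, map_zero_left]
  have h1 := hh.perturbation_map_tensorGhost (parity α) (map (koszul₁ Q) g)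
  rw [h0, map_zero, zero_add, ← hg] at h1
  rw [LinearMap.comp_apply, ghostExtSeries_map_tensorGhost, ← h1, ← LinearMap.comp_apply,
    qRestriction_comp_perturbation, ghostMap_map_tensorGhost, h0, map_zero, LinearMap.zero_apply]

theorem qRestriction_unique
    {R : FormalSeries (Ghost 𝔤 (Smooth E M)) →ₗ[PowerSeries ℂ] FormalSeries (Ghost 𝔤 (Smooth F C))}
    (hR : R ∘ₗ ghostExtSeries 𝔤 (qKoszul₁ Q) = 0) (hR' : R ∘ₗ ghostMap 𝔤 prol = LinearMap.id) :
    R = qRestriction Q res h := by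
  refine eq_qRestriction ?_
  rw [hh.perturbation_eq, LinearMap.comp_add, ← LinearMap.comp_assoc, ← LinearMap.comp_assoc, hR,
    hR', LinearMap.zero_comp, add_zero, LinearMap.id_comp]

theorem ker_qRestriction (hres : res ∘ₗ koszul₁ Q = 0) :
    LinearMap.ker (qRestriction Q res h) = LinearMap.range (ghostExtSeries 𝔤 (qKoszul₁ Q)) := by
  apply le_antisymm
  · intro y hy
    obtain ⟨z, rfl⟩ := ((Module.End.isUnit_iff _).1 (isUnit_perturbation Q h)).2 y
    rw [LinearMap.mem_ker, ← LinearMap.comp_apply, qRestriction_comp_perturbation] at hy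
    rw [hh.perturbation_eq, LinearMap.add_apply, LinearMap.comp_apply, hy, map_zero, zero_add]
    exact ⟨_, rfl⟩
  · exact LinearMap.range_le_ker_iff.2 (hh.qRestriction_comp_qKoszul₁ hres)

theorem isIdempotentElem_prol_qRestriction :
    IsIdempotentElem (M := Module.End (PowerSeries ℂ) (FormalSeries (Ghost 𝔤 (Smooth E M))))
      (ghostMap 𝔤 prol ∘ₗ qRestriction Q res h) := by
  refine LinearMap.ext fun f => ?_
  have h1 := LinearMap.congr_fun hh.qRestriction_comp_prol (qRestriction Q res h f)
  exact congrArg (ghostMap 𝔤 prol) h1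

theorem range_prol_qRestriction :
    LinearMap.range (ghostMap 𝔤 prol ∘ₗ qRestriction Q res h)
      = FormalSeries.sub (ghostSub 𝔤 (LinearMap.range prol)) := by
  have hs : LinearMap.range (qRestriction Q res h) = ⊤ :=
    LinearMap.range_eq_top.2 fun φ =>
      ⟨ghostMap 𝔤 prol φ, LinearMap.congr_fun hh.qRestriction_comp_prol φ⟩
  rw [LinearMap.range_comp_of_range_eq_top _ hs, ghostMap, range_map, range_ghostExt]

theorem ker_prol_qRestriction (hres : res ∘ₗ koszul₁ Q = 0) :
    LinearMap.ker (ghostMap 𝔤 prol ∘ₗ qRestriction Q res h)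
      = ghostSubSeries 𝔤 (quantumIdeal Q) := by
  have hi : LinearMap.ker (ghostMap 𝔤 prol : FormalSeries (Ghost 𝔤 (Smooth F C)) →ₗ[PowerSeries ℂ]
      FormalSeries (Ghost 𝔤 (Smooth E M))) = ⊥ :=
    LinearMap.ker_eq_bot.2 (Function.LeftInverse.injective (g := qRestriction Q res h)
      fun φ => LinearMap.congr_fun hh.qRestriction_comp_prol φ)
  rw [LinearMap.ker_comp_of_ker_eq_bot _ hi, hh.ker_qRestriction hres, range_ghostExtSeries,
    quantumIdeal]

end IsKoszulHomotopy

end Perturbation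

end BRST

open BRST in
theorem mainTheorem6
    {E : Type*} [NormedAddCommGroup E] [NormedSpace ℝ E] [FiniteDimensional ℝ E]
    {M : Type*} [TopologicalSpace M] [ChartedSpace E M] [IsManifold 𝓘(ℝ, E) ∞ M]
    [T2Space M] [SecondCountableTopology M]
    {Ω : SymplecticForm E M} {S : StarProduct Ω}
    {𝔤 : Type*} [LieRing 𝔤] [LieAlgebra ℝ 𝔤] [FiniteDimensional ℝ 𝔤]
    (Q : QuantumMomentumMap S 𝔤)
    {F : Type*} [NormedAddCommGroup F] [NormedSpace ℝ F] [FiniteDimensional ℝ F]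
    {C : Type*} [TopologicalSpace C] [ChartedSpace F C] [IsManifold 𝓘(ℝ, F) ∞ C]
    (ι : C → M) (hC : Q.IsRegularConstraintSurface ι)
    (prol : Smooth F C →ₗ[ℂ] Smooth E M)
    (h : Antighost 𝔤 (Smooth E M) →ₗ[ℂ] Antighost 𝔤 (Smooth E M))
    (hh : IsKoszulHomotopy Q (pullback ι hC.embedding.contMDiff) prol h) :
    -- `λ B₁ = ∂₁ - ∂̂₁`, and `id₀ - λ B₁ h₀` is invertible
    (PowerSeries.X : PowerSeries ℂ) • opB₁ Q
        = ghostMap 𝔤 (koszul₁ Q) - ghostExtSeries 𝔤 (qKoszul₁ Q) ∧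
    IsUnit (perturbation Q h) ∧
    -- the deformed restriction has the three properties
    FormalSeries.opCoeff (qRestriction Q (pullback ι hC.embedding.contMDiff) h) 0
        = ghostExt 𝔤 (pullback ι hC.embedding.contMDiff) ∧
    qRestriction Q (pullback ι hC.embedding.contMDiff) h ∘ₗ ghostExtSeries 𝔤 (qKoszul₁ Q) = 0 ∧
    qRestriction Q (pullback ι hC.embedding.contMDiff) h ∘ₗ ghostMap 𝔤 prol = LinearMap.id ∧
    -- and it is the only one
    (∀ R : FormalSeries (Ghost 𝔤 (Smooth E M)) →ₗ[PowerSeries ℂ]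
          FormalSeries (Ghost 𝔤 (Smooth F C)),
        FormalSeries.opCoeff R 0 = ghostExt 𝔤 (pullback ι hC.embedding.contMDiff) →
        R ∘ₗ ghostExtSeries 𝔤 (qKoszul₁ Q) = 0 →
        R ∘ₗ ghostMap 𝔤 prol = LinearMap.id →
        R = qRestriction Q (pullback ι hC.embedding.contMDiff) h) ∧
    -- `prol ι_q^*` is a projection, with the asserted image and kernel
    IsIdempotentElem (M := Module.End (PowerSeries ℂ) (FormalSeries (Ghost 𝔤 (Smooth E M))))
      (ghostMap 𝔤 prol ∘ₗ qRestriction Q (pullback ι hC.embedding.contMDiff) h) ∧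
    LinearMap.range (ghostMap 𝔤 prol ∘ₗ qRestriction Q (pullback ι hC.embedding.contMDiff) h)
        = FormalSeries.sub (ghostSub 𝔤 (LinearMap.range prol)) ∧
    LinearMap.ker (ghostMap 𝔤 prol ∘ₗ qRestriction Q (pullback ι hC.embedding.contMDiff) h)
        = ghostSubSeries 𝔤 (quantumIdeal Q) ∧
    -- the direct sum decomposition
    IsCompl (FormalSeries.sub (ghostSub 𝔤 (LinearMap.range prol)))
      (ghostSubSeries 𝔤 (quantumIdeal Q)) := by
  have hres := pullback_comp_koszul₁ hC
  refine ⟨X_smul_opB₁ Q, isUnit_perturbation Q h, opCoeff_zero_qRestriction _ h,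
    hh.qRestriction_comp_qKoszul₁ hres, hh.qRestriction_comp_prol,
    fun R _ hR hR' => hh.qRestriction_unique hR hR', hh.isIdempotentElem_prol_qRestriction,
    hh.range_prol_qRestriction, hh.ker_prol_qRestriction hres, ?_⟩
  rw [← hh.range_prol_qRestriction, ← hh.ker_prol_qRestriction hres]
  exact LinearMap.IsIdempotentElem.isCompl hh.isIdempotentElem_prol_qRestriction
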